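/- **Setting.** Let $D\subseteq\mathbb R^d$ be open, $f:D\to\mathbb R$ bounded below, $\mathsf P$ a probability distribution, and $f(\cdot,\xi):D\to\mathbb R$ component functions. Let $L_0,L_\rho,\sigma\ge 0$, $0\le\rho<1$, $\lambda>0$, and assume: * $f$ and every $f(\cdot,\xi)$ are $(L_0,L_\rho)$-smooth on $D$: twice differentiable on $D$ with $\|\nabla^2 h(x)\|\le L_0+L_\rho\|\nabla h(x)\|^\rho$ for almost every $x\in D$ ($h=f$ or $h=f(\cdot,\xi)$; Euclidean and spectral norms, $u^0=1$); * for every $x\in D$, $\mathbb E_{\xi\sim\mathsf P}[\nabla f(x,\xi)]=\nabla f(x)$ and $\|\nabla f(x,\xi)-\nabla f(x)\|\le\sigma$ almost surely. **Algorithm (VRAdam)**, with parameters $\eta,\beta,\beta_2,\lambda,T,S_1$ and initial point $x_1\in D$. Operations on vectors are coordinatewise. Let $m_1$ be the average of $\nabla f(x_1,\cdot)$ over a batch of $S_1$ samples, $v_1=\beta_2m_1^2$ and $x_2=x_1-\eta m_1/(|m_1|+\lambda)$. For $t=2,\dots,T$ draw a new sample $\xi_t$ and put $$m_t=(1-\beta)m_{t-1}+\beta\nabla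 f(x_t,\xi_t)+(1-\beta)\bigl(\nabla f(x_t,\xi_t)-\nabla f(x_{t-1},\xi_t)\bigr),$$ $$v_t=(1-\beta_2)v_{t-1}+\beta_2(\nabla f(x_t,\xi_t))^2,\qquad \hat v_t=\frac{v_t}{1-(1-\beta_2)^t},\qquad x_{t+1}=x_t-\frac{\eta}{\sqrt{\hat v_t}+\lambda}\odot m_t,$$ where $\hat v_t:=0$ if $\beta_2=0$. The batch samples and $\xi_2,\dots,\xi_T$ are i.i.d. from $\mathsf P$, and almost surely the segments $[x_t,x_{t+1}]$, $1\le t\le T$, lie in $D$ (no condition if $D=\mathbb R^d$). **Notation.** $\Delta_1=f(x_1)-\inf_D f$, and for $G>0$ $$L=3L_0+4L_\rho G^\rho,\qquad r=\min\Bigl\{\tfrac1{5L_\rho G^{\rho-1}},\tfrac1{5(L_0^{\rho-1}L_\rho)^{1/\rho}}\Bigr\},\qquad \theta=40L\sqrt G\,\lambda^{-3/2},$$ where the second entry of $r$ is omitted if $\rho=0$ or $L_0=0$. Here and below a quotient of a positive number by $0$ is $+\infty$. **Theorem.** There are numerical constants $c,C>0$ such that the following holds. (a) Let $0<\delta<1$,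 $0\le\rho<1$, $\varepsilon>0$, $0\le\beta_2\le1$, and let $G>0$ satisfy $$G\ge\max\Bigl\{2\lambda,\;2\sigma,\;2\|\nabla f(x_1)\|,\;\tfrac{C\Delta_1L_0}{\delta\lambda},\;\bigl(\tfrac{C\Delta_1L_\rho}{\delta\lambda}\bigr)^{\frac1{1-\rho}}\Bigr\}.$$ Choose $\eta>0$, $\beta$, $T$ and $S_1$ with $$\eta\le c\min\Bigl\{\tfrac{r\lambda}{G},\;\tfrac{\lambda}{L},\;\tfrac{\lambda^2G\delta}{\Delta_1L^2},\;\tfrac{\lambda^2\sqrt\delta\,\varepsilon}{\sigma GL}\Bigr\},\quad \beta=\theta^2\eta^2\le1,\quad T=\Bigl\lceil\tfrac{C\,G\Delta_1}{\eta\delta\varepsilon^2}\Bigr\rceil,\quad S_1\ge\tfrac1{2\beta^2T}.$$ Then, with probability at least $1-\delta$, $\|\nabla f(x_t)\|\le G$ for every $1\le t\le T$ and $$\frac1T\sum_{t=1}^T\|\nabla f(x_t)\|^2\le\varepsilon^2 .$$ (b) Dimension-free $O(\varepsilon^{-3})$ gradient complexity: suppose moreover $\Delta_1>0$ and $L_0+L_\rho>0$.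 Then there is a $K$ depending only on $\delta,\rho,\lambda,\sigma,L_0,L_\rho,\Delta_1,\|\nabla f(x_1)\|,G$ (in particular not on $d$ or $\varepsilon$) such that for every $0<\varepsilon\le1$ the parameters $\eta,\beta,T,S_1$ can be chosen as in (a) so that VRAdam evaluates at most $K\varepsilon^{-3}$ stochastic gradients, their number being $S_1+2(T-1)$. -/

import Mathlib

open MeasureTheory ProbabilityTheory
open scoped ENNReal

namespace VRAdam

/-- `ℝ^d` with the Euclidean norm. -/
abbrev Vec (d : ℕ) : Type := EuclideanSpace ℝ (Fin d)

/-- `(L₀, L_ρ)`-smoothness on the open domain `D`: the function is twice differentiable on `D`, and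
`‖∇²f(x)‖ ≤ L₀ + L_ρ ‖∇f(x)‖^ρ` (spectral norm of the Hessian) for almost every `x ∈ D`. -/
def GenSmoothOn {d : ℕ} (D : Set (Vec d)) (ρ L₀ Lρ : ℝ) (f : Vec d → ℝ) : Prop :=
  DifferentiableOn ℝ f D ∧ DifferentiableOn ℝ (gradient f) D ∧
    ∀ᵐ x ∂(volume.restrict D), ‖fderiv ℝ (gradient f) x‖ ≤ L₀ + Lρ * ‖gradient f x‖ ^ ρ

/-- The stochastic gradient `∇f(x, ξ)`: the gradient in `x` of the component function `f(·, ξ)`. -/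
noncomputable def sgrad {d : ℕ} {Ξ : Type*} (F : Vec d → Ξ → ℝ) (x : Vec d) (ξ : Ξ) : Vec d :=
  gradient (fun y => F y ξ) x

/-- The quantities attached to time `t`: the iterate `x_t`, the momenta `m_t` and `v_t`,
and the next iterate `x_{t+1}`. -/
structure State (d : ℕ) where
  x : Vec d
  m : Vec d
  v : Vec d
  next : Vec d

section Algorithm

variable {d : ℕ} {Ξ : Type*} (F : Vec d → Ξ → ℝ) (η β βsq lam : ℝ)

/-- The initialization (time `t = 1`): `m₁` is the average of the stochastic gradients over the
batch, `v₁ = β_sq m₁²`, `x₁ = x_init`, `x₂ = x_init - η m₁ / (|m₁| + λ)` coordinatewise. -/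
noncomputable def initState (xinit : Vec d) {S₁ : ℕ} (batch : Fin S₁ → Ξ) : State d :=
  let m₁ : Vec d := (S₁ : ℝ)⁻¹ • ∑ j, sgrad F xinit (batch j)
  { x := xinit
    m := m₁
    v := WithLp.toLp 2 fun i => βsq * m₁ i ^ 2
    next := WithLp.toLp 2 fun i => xinit i - η * m₁ i / (|m₁ i| + lam) }

/-- The update at time `t ≥ 2` with the new sample `ξ`, from the state `s` of time `t - 1`.
(For `β_sq = 0` one has `v_t = 0`, and `v̂_t = 0 / 0` is read as `0`.) -/
noncomputable def stepState (t : ℕ) (ξ : Ξ) (s : State d) : State d :=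
  let x : Vec d := s.next
  let g : Vec d := sgrad F x ξ
  let m : Vec d := (1 - β) • s.m + β • g + (1 - β) • (g - sgrad F s.x ξ)
  let v : Vec d := WithLp.toLp 2 fun i => (1 - βsq) * s.v i + βsq * g i ^ 2
  let vhat : Vec d := WithLp.toLp 2 fun i => v i / (1 - (1 - βsq) ^ t)
  { x := x
    m := m
    v := v
    next := WithLp.toLp 2 fun i => x i - η / (√(vhat i) + lam) * m i }

/-- `state k` is the state at time `t = k + 1`; the sample drawn at time `t ≥ 2` is `ξ t`. -/
noncomputable def state (xinit : Vec d) {S₁ : ℕ} (batch : Fin S₁ → Ξ) (ξ : ℕ → Ξ) : ℕ → State d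
  | 0 => initState F η βsq lam xinit batch
  | k + 1 => stepState F η β βsq lam (k + 2) (ξ (k + 2)) (state xinit batch ξ k)

/-- The iterate `x_t` of VRAdam, for `t ≥ 1`. -/
noncomputable def iter (xinit : Vec d) {S₁ : ℕ} (batch : Fin S₁ → Ξ) (ξ : ℕ → Ξ) (t : ℕ) : Vec d :=
  (state F η β βsq lam xinit batch ξ (t - 1)).x

end Algorithm

/-- The number of stochastic gradients evaluated by VRAdam: `S₁` at the initialization
and two in each of the iterations `t = 2, …, T`. -/
def gradEvals (S₁ T : ℕ) : ℕ := S₁ + 2 * (T - 1)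

/-- `Δ₁ = f(x₁) - inf_D f`. -/
noncomputable def initGap {d : ℕ} (D : Set (Vec d)) (f : Vec d → ℝ) (x₁ : Vec d) : ℝ :=
  f x₁ - sInf (f '' D)

/-- `L = 3 L₀ + 4 L_ρ G^ρ`. -/
noncomputable def effL (ρ L₀ Lρ G : ℝ) : ℝ := 3 * L₀ + 4 * Lρ * G ^ ρ

/-- `r = min {1 / (5 L_ρ G^(ρ-1)), 1 / (5 (L₀^(ρ-1) L_ρ)^(1/ρ))}`, with `1 / 0 = ∞`; the second
entry is meaningful for `ρ > 0` and `L₀ > 0` only, and is `∞` if `ρ = 0` or `L₀ = 0`. -/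
noncomputable def effR (ρ L₀ Lρ G : ℝ) : ℝ≥0∞ :=
  min (ENNReal.ofReal (5 * Lρ * G ^ (ρ - 1)))⁻¹
    (if ρ = 0 ∨ L₀ = 0 then ∞ else (ENNReal.ofReal (5 * (L₀ ^ (ρ - 1) * Lρ) ^ (1 / ρ)))⁻¹)

/-- `min {r λ / G, λ / L, λ² G δ / (Δ₁ L²), λ² √δ ε / (σ G L)}`, where a quotient of a positive
number by zero is `∞`. -/
noncomputable def stepBound (δ ρ lam σ L₀ Lρ Δ ε G : ℝ) : ℝ≥0∞ :=
  let L := effL ρ L₀ Lρ G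
  min (min (effR ρ L₀ Lρ G * ENNReal.ofReal (lam / G)) (ENNReal.ofReal lam / ENNReal.ofReal L))
    (min (ENNReal.ofReal (lam ^ 2 * G * δ) / ENNReal.ofReal (Δ * L ^ 2))
      (ENNReal.ofReal (lam ^ 2 * √δ * ε) / ENNReal.ofReal (σ * G * L)))

/-- `G` is large enough (`g₁` stands for `‖∇f(x₁)‖`, and `Δ` for `Δ₁`). -/
structure LargeG (C δ ρ lam σ L₀ Lρ Δ g₁ G : ℝ) : Prop where
  pos : 0 < G
  lam_le : 2 * lam ≤ G
  sigma_le : 2 * σ ≤ G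
  grad_le : 2 * g₁ ≤ G
  zero_le : C * Δ * L₀ / (δ * lam) ≤ G
  rho_le : (C * Δ * Lρ / (δ * lam)) ^ (1 / (1 - ρ)) ≤ G

/-- The choice of `η`, `β`, `T` and `S₁`. -/
structure Choice (c C δ ρ lam σ L₀ Lρ Δ ε G η β : ℝ) (T S₁ : ℕ) : Prop where
  eta_pos : 0 < η
  eta_le : ENNReal.ofReal η ≤ ENNReal.ofReal c * stepBound δ ρ lam σ L₀ Lρ Δ ε G
  beta_eq : β = (40 * effL ρ L₀ Lρ G * √G * lam ^ (-(3 / 2) : ℝ)) ^ 2 * η ^ 2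
  beta_le : β ≤ 1
  T_eq : T = ⌈C * (G * Δ / (η * δ * ε ^ 2))⌉₊
  batch_le : (ENNReal.ofReal (2 * β ^ 2 * T))⁻¹ ≤ S₁

end VRAdam

/-! The difficulty is that the gradient of `f` is only locally Lipschitz, so every estimate is
available only while the gradient stays of order `G`, which itself has to be proved. The proof stops
the run at its first bad state and shows by Markov's inequality that stopping is unlikely.

While the gradient and the momentum error `m - ∇f` are at most `G`, steps are so short that the
gradients of `f` and of its components are Lipschitz with constant `effL` along them
(`GenSmoothOn.norm_gradient_sub_le`). The bias-corrected `v` is a weighted average of squares of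
bounded entries, so all coordinatewise step sizes lie in `[η / (2 G), η / λ]`. The method is then a
gradient descent with a bounded preconditioner: a step lowers `f` by `η / (8 G) ‖∇f‖²` up to `3 η /
(4 λ) ‖m - ∇f‖²` (`Good.descent`).

The new error is `(1 - β)` times the old one plus a vector that is centred given the past and
bounded by `β σ + 2 L ‖step‖`. Its second moment therefore contracts by `1 - β / 2`, up to a noise
term and a small multiple of `‖∇f‖²` (`Good.lintegral_err_sq_le`). The relation `β = θ² η²` makes
that multiple small enough for the descent inequality and the variance recursion to close on each
other. Up to the stopping time they bound the expected sums of `‖∇f‖²` and of the squared errors by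
a multiple of `G Δ₁ / η` (`expected_gradSq_bound`, `expected_exit_le`).

A run becomes bad in one of two ways. Either the error exceeds `G`; the same recursion controls the
expected squared error at the exit. Or the gradient climbs from `G / 2` to `G`; a step moves it by
at most `(L η / λ) ‖m‖`, and above `G / 2` one has `‖m‖ ≤ (3 / G) (‖∇f‖² + ‖m - ∇f‖²)`, so the climb
needs a large sum of squares (`norm_gradExt_le_of_good`), which the lower bound on `G` makes
improbable. Markov's inequality for these two events and for the average squared gradient gives (a);
see `exists_exceptional_set`. For (b), `η` of order `ε` gives `T` of order `ε⁻³` and `S₁` of order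
`ε⁻¹`. -/

namespace VRAdam

/-! ### Generalized smoothness: from an almost-everywhere Hessian bound to local Lipschitz gradients
and descent -/

/-- A function on an interval that is differentiable everywhere, with derivative bounded almost
everywhere, satisfies the mean value inequality. -/
theorem norm_sub_le_of_ae_norm_deriv_le {E' : Type*} [NormedAddCommGroup E'] [NormedSpace ℝ E']
    [CompleteSpace E'] {φ φ' : ℝ → E'} {M : ℝ}
    (hd : ∀ t ∈ Set.Icc (0 : ℝ) 1, HasDerivAt φ (φ' t) t)
    (hb : ∀ᵐ t : ℝ, t ∈ Set.Icc (0 : ℝ) 1 → ‖φ' t‖ ≤ M) : ‖φ 1 - φ 0‖ ≤ M := by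
  have huIcc : Set.uIcc (0 : ℝ) 1 = Set.Icc 0 1 := Set.uIcc_of_le zero_le_one
  have hsub : Set.uIoc (0 : ℝ) 1 ⊆ Set.Icc 0 1 := by
    rw [Set.uIoc_of_le zero_le_one]; exact Set.Ioc_subset_Icc_self
  have hd' : ∀ t ∈ Set.uIcc (0 : ℝ) 1, HasDerivAt φ (deriv φ t) t := by
    intro t ht
    rw [huIcc] at ht
    rw [(hd t ht).deriv]; exact hd t ht
  have hb' : ∀ᵐ t : ℝ, t ∈ Set.uIoc (0 : ℝ) 1 → ‖deriv φ t‖ ≤ M := by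
    filter_upwards [hb] with t ht hts
    rw [(hd t (hsub hts)).deriv]; exact ht (hsub hts)
  -- A derivative that exists everywhere and is bounded almost everywhere is integrable, so the
  -- fundamental theorem of calculus applies without continuity of the derivative.
  have hint : IntervalIntegrable (deriv φ) volume 0 1 := by
    rw [intervalIntegrable_iff]
    refine Measure.integrableOn_of_bounded (M := M) ?_ (aestronglyMeasurable_deriv _ _) ?_
    · simp
    · exact (ae_restrict_iff' measurableSet_uIoc).2 hb'
  rw [← intervalIntegral.integral_eq_sub_of_hasDerivAt hd' hint]
  simpa using intervalIntegral.norm_integral_le_of_norm_le_const_ae hb'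

/-- If a function is differentiable everywhere on a ball and its derivative is bounded by `M`
almost everywhere there, then the derivative at the centre is bounded by `M`. -/
theorem norm_fderiv_le_of_ae_ball {d : ℕ} {g : Vec d → Vec d} {x : Vec d} {R M : ℝ} (hR : 0 < R)
    (hM : 0 ≤ M) (hd : ∀ y ∈ Metric.ball x R, DifferentiableAt ℝ g y)
    (hb : ∀ᵐ y : Vec d, y ∈ Metric.ball x R → ‖fderiv ℝ g y‖ ≤ M) : ‖fderiv ℝ g x‖ ≤ M := by
  have key : ∀ h : Vec d, ‖h‖ < R / 2 → ‖g (x + h) - g x‖ ≤ M * ‖h‖ := by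
    intro h hh
    set N := toMeasurable volume {y : Vec d | ¬ (y ∈ Metric.ball x R → ‖fderiv ℝ g y‖ ≤ M)} with hN
    have hNm : MeasurableSet N := measurableSet_toMeasurable _ _
    have hN0 : volume N = 0 := by rw [hN, measure_toMeasurable]; exact hb
    have hNb : ∀ y ∉ N, y ∈ Metric.ball x R → ‖fderiv ℝ g y‖ ≤ M := by
      intro y hy
      by_contra hc
      exact hy (subset_toMeasurable _ _ hc)
    -- The segment from `x` to `x + h` may lie inside the null set. By Fubini almost every parallel
    -- translate meets it in a null set of parameters, and such translates are dense.
    have h1 : ∀ᵐ t : ℝ, ∀ᵐ y : Vec d, y + t • h ∉ N := by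
      refine Filter.Eventually.of_forall fun t => ?_
      have := (measurePreserving_add_right (volume : Measure (Vec d)) (t • h)).quasiMeasurePreserving
      exact this.ae (measure_eq_zero_iff_ae_notMem.1 hN0)
    have hmeas : MeasurableSet {q : ℝ × Vec d | q.2 + q.1 • h ∉ N} := by
      have hm : Measurable fun q : ℝ × Vec d => q.2 + q.1 • h := by fun_prop
      exact hm hNm.compl
    have h2 := (Measure.ae_ae_comm (μ := (volume : Measure ℝ)) (ν := (volume : Measure (Vec d)))
      (p := fun t y => y + t • h ∉ N) hmeas).1 h1
    have hdense := Measure.dense_of_ae h2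
    -- A strict violation at `x` would persist at nearby base points, by continuity of `g`, and one
    -- of these starts a translate on which the mean value inequality holds.
    by_contra! hlt
    have hx : DifferentiableAt ℝ g x := hd x (Metric.mem_ball_self hR)
    have hxh : DifferentiableAt ℝ g (x + h) := hd _ (by simp; linarith)
    have hcont : ContinuousAt (fun y => ‖g (y + h) - g y‖) x := by
      refine ContinuousAt.norm (ContinuousAt.sub ?_ hx.continuousAt)
      exact ContinuousAt.comp (f := fun y => y + h) hxh.continuousAt (by fun_prop)
    have hev : ∀ᶠ y in nhds x, M * ‖h‖ < ‖g (y + h) - g y‖ := hcont.eventually_const_lt hlt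
    have hball : ∀ᶠ y in nhds x, y ∈ Metric.ball x (R / 2) := Metric.ball_mem_nhds x (by linarith)
    obtain ⟨y, hy, hyd⟩ := hdense.inter_nhds_nonempty (hev.and hball)
    have hseg : ∀ t ∈ Set.Icc (0 : ℝ) 1, y + t • h ∈ Metric.ball x R := by
      intro t ht
      have hy2 := hyd.2
      rw [Metric.mem_ball, dist_eq_norm] at hy2 ⊢
      have : ‖t • h‖ ≤ ‖h‖ := by
        rw [norm_smul, Real.norm_of_nonneg ht.1]
        exact mul_le_of_le_one_left (norm_nonneg _) ht.2
      calc ‖y + t • h - x‖ = ‖(y - x) + t • h‖ := by congr 1; abel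
        _ ≤ ‖y - x‖ + ‖t • h‖ := norm_add_le _ _
        _ < R := by linarith
    have hder : ∀ t ∈ Set.Icc (0 : ℝ) 1,
        HasDerivAt (fun t : ℝ => g (y + t • h)) (fderiv ℝ g (y + t • h) h) t := by
      intro t ht
      have h3 : HasDerivAt (fun t : ℝ => y + t • h) h t := by
        simpa using ((hasDerivAt_id t).smul_const h).const_add y
      exact (hd _ (hseg t ht)).hasFDerivAt.comp_hasDerivAt t h3
    have := norm_sub_le_of_ae_norm_deriv_le (M := M * ‖h‖) hder (by
      filter_upwards [hy] with t ht htI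
      exact ContinuousLinearMap.le_of_opNorm_le _ (hNb _ ht (hseg t htI)) h)
    simp only [one_smul, zero_smul, add_zero] at this
    linarith [hyd.1]
  refine (hd x (Metric.mem_ball_self hR)).hasFDerivAt.le_of_lip' hM ?_
  filter_upwards [Metric.ball_mem_nhds x (show 0 < R / 2 by linarith)] with y hy
  have := key (y - x) (by rwa [Metric.mem_ball, dist_eq_norm] at hy)
  simpa using this

/-- The Hessian bound in `GenSmoothOn` holds everywhere on the open domain. -/
theorem GenSmoothOn.norm_fderiv_le {d : ℕ} {D : Set (Vec d)} {ρ L₀ Lρ : ℝ} {f : Vec d → ℝ}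
    (hf : GenSmoothOn D ρ L₀ Lρ f) (hD : IsOpen D) (hρ : 0 ≤ ρ) (hL₀ : 0 ≤ L₀) (hLρ : 0 ≤ Lρ)
    {x : Vec d} (hx : x ∈ D) :
    ‖fderiv ℝ (gradient f) x‖ ≤ L₀ + Lρ * ‖gradient f x‖ ^ ρ := by
  have hdiff : ∀ y ∈ D, DifferentiableAt ℝ (gradient f) y := fun y hy =>
    (hf.2.1 y hy).differentiableAt (hD.mem_nhds hy)
  refine le_of_forall_pos_le_add fun e he => ?_
  have hcont : ContinuousAt (fun y => L₀ + Lρ * ‖gradient f y‖ ^ ρ) x :=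
    continuousAt_const.add (continuousAt_const.mul
      ((hdiff x hx).continuousAt.norm.rpow_const (Or.inr hρ)))
  have hev := (hcont.eventually_lt_const (lt_add_of_pos_right _ he)).and (hD.mem_nhds hx)
  obtain ⟨R, hR, hball⟩ := Metric.eventually_nhds_iff_ball.1 hev
  refine norm_fderiv_le_of_ae_ball hR (by positivity) (fun y hy => hdiff y (hball y hy).2) ?_
  filter_upwards [(ae_restrict_iff' hD.measurableSet).1 hf.2.2] with y hy hyb
  exact (hy (hball y hyb).2).trans (hball y hyb).1.le

/-- A level `A` below which the Hessian bound does not exceed `effL`, and which a curve of length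
`R` starting at gradient norm `2 G` cannot double. -/
theorem exists_gradient_level {ρ L₀ Lρ G R : ℝ} (hρ : 0 ≤ ρ) (hρ1 : ρ < 1) (hL₀ : 0 ≤ L₀)
    (hLρ : 0 ≤ Lρ) (hG : 0 < G) (hR : 0 ≤ R) (h1 : 10 * (R * (Lρ * G ^ ρ)) ≤ G)
    (h2 : ρ ≠ 0 → L₀ ≠ 0 → 10 * (R * (L₀ ^ (ρ - 1) * Lρ) ^ (1 / ρ)) ≤ 1) :
    ∃ A, 2 * G ≤ A ∧ R * effL ρ L₀ Lρ G < A ∧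
      ∀ u, 0 ≤ u → u ≤ 2 * A → L₀ + Lρ * u ^ ρ ≤ effL ρ L₀ Lρ G := by
  have hGρ : 0 < G ^ ρ := Real.rpow_pos_of_pos hG ρ
  unfold effL
  have hLG : 0 ≤ Lρ * G ^ ρ := by positivity
  -- For `ρ = 0` or `Lρ = 0` the Hessian bound is constant, and `A` only has to be large.
  rcases eq_or_lt_of_le hρ with h0 | hρpos
  · refine ⟨2 * G + R * (3 * L₀ + 4 * Lρ * G ^ ρ) + 1, ?_, by linarith, ?_⟩
    · have : 0 ≤ R * (3 * L₀ + 4 * Lρ * G ^ ρ) := by positivity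
      linarith
    · intro u _ _
      rw [← h0]; simp; linarith
  rcases eq_or_lt_of_le hLρ with h0 | hLpos
  · refine ⟨2 * G + R * (3 * L₀ + 4 * Lρ * G ^ ρ) + 1, ?_, by linarith, ?_⟩
    · have : 0 ≤ R * (3 * L₀ + 4 * Lρ * G ^ ρ) := by positivity
      linarith
    · intro u _ _
      rw [← h0]; simp; linarith
  have h4 : (4 : ℝ) ^ ρ ≤ 4 := by
    simpa using Real.rpow_le_rpow_of_exponent_le (by norm_num : (1 : ℝ) ≤ 4) hρ1.le
  have h4G : ∀ u, 0 ≤ u → u ≤ 4 * G → Lρ * u ^ ρ ≤ 4 * (Lρ * G ^ ρ) := by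
    intro u hu huG
    have : u ^ ρ ≤ 4 * G ^ ρ := by
      calc u ^ ρ ≤ (4 * G) ^ ρ := Real.rpow_le_rpow hu huG hρ
        _ = 4 ^ ρ * G ^ ρ := Real.mul_rpow (by norm_num) hG.le
        _ ≤ 4 * G ^ ρ := by gcongr
    nlinarith
  rcases eq_or_lt_of_le hL₀ with h0 | hL₀pos
  · refine ⟨2 * G, le_rfl, ?_, ?_⟩
    · rw [← h0]; nlinarith
    · intro u hu hu2
      have := h4G u hu (by linarith)
      rw [← h0]; linarith
  -- `B` is the gradient norm at which `L₀` and `Lρ u ^ ρ` balance. Up to `2 B` the second term is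
  -- at most `2 L₀`, and up to `4 G` it is at most `4 Lρ G ^ ρ`: hence the coefficients 3 and 4 in
  -- `effL`.
  · set B : ℝ := (L₀ / Lρ) ^ (1 / ρ) with hB
    have hBpos : 0 < B := Real.rpow_pos_of_pos (by positivity) _
    have hBρ : B ^ ρ = L₀ / Lρ := by
      rw [hB, ← Real.rpow_mul (by positivity)]
      rw [one_div_mul_cancel hρpos.ne', Real.rpow_one]
    -- Thus the second entry of `r` is `B / (5 L₀)`, and `h2` says that `10 R L₀ ≤ B`.
    have hkey : (L₀ ^ (ρ - 1) * Lρ) ^ (1 / ρ) * B = L₀ := by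
      rw [hB, ← Real.mul_rpow (by positivity) (by positivity)]
      have : L₀ ^ (ρ - 1) * Lρ * (L₀ / Lρ) = L₀ ^ ρ := by
        rw [Real.rpow_sub_one hL₀pos.ne']; field_simp
      rw [this, ← Real.rpow_mul hL₀, mul_one_div_cancel hρpos.ne', Real.rpow_one]
    have h2' := h2 hρpos.ne' hL₀pos.ne'
    have hRL : 10 * (R * L₀) ≤ B := by
      calc 10 * (R * L₀) = 10 * (R * (L₀ ^ (ρ - 1) * Lρ) ^ (1 / ρ)) * B := by
            linear_combination (-10 * R) * hkey
        _ ≤ 1 * B := by gcongr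
        _ = B := one_mul B
    refine ⟨max B (2 * G), le_max_right _ _, ?_, ?_⟩
    · have := le_max_left B (2 * G)
      have := le_max_right B (2 * G)
      nlinarith
    · intro u hu hu2
      rcases le_total B (2 * G) with hBG | hBG
      · rw [max_eq_right hBG] at hu2
        have := h4G u hu (by linarith)
        linarith
      · rw [max_eq_left hBG] at hu2
        have h22 : (2 : ℝ) ^ ρ ≤ 2 := by
          simpa using Real.rpow_le_rpow_of_exponent_le (by norm_num : (1 : ℝ) ≤ 2) hρ1.le
        have : Lρ * u ^ ρ ≤ 2 * L₀ := by
          calc Lρ * u ^ ρ ≤ Lρ * (2 * B) ^ ρ := by gcongr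
            _ = 2 ^ ρ * (Lρ * (L₀ / Lρ)) := by
                rw [Real.mul_rpow (by norm_num) hBpos.le, hBρ]; ring
            _ = 2 ^ ρ * L₀ := by field_simp
            _ ≤ 2 * L₀ := by gcongr
        linarith

/-- Along a short segment starting at a point of gradient norm at most `2 G`, the gradient is
Lipschitz with constant `effL`. -/
theorem GenSmoothOn.norm_gradient_sub_le {d : ℕ} {D : Set (Vec d)} {ρ L₀ Lρ G : ℝ} {f : Vec d → ℝ}
    (hf : GenSmoothOn D ρ L₀ Lρ f) (hD : IsOpen D) (hρ : 0 ≤ ρ) (hρ1 : ρ < 1) (hL₀ : 0 ≤ L₀)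
    (hLρ : 0 ≤ Lρ) (hG : 0 < G) {x y : Vec d} (hxy : segment ℝ x y ⊆ D)
    (hx : ‖gradient f x‖ ≤ 2 * G) (h1 : 10 * (‖y - x‖ * (Lρ * G ^ ρ)) ≤ G)
    (h2 : ρ ≠ 0 → L₀ ≠ 0 → 10 * (‖y - x‖ * (L₀ ^ (ρ - 1) * Lρ) ^ (1 / ρ)) ≤ 1) :
    ∀ p ∈ segment ℝ x y, ‖gradient f p - gradient f x‖ ≤ effL ρ L₀ Lρ G * ‖p - x‖ := by
  obtain ⟨A, hA, hRA, hlev⟩ :=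
    exists_gradient_level hρ hρ1 hL₀ hLρ hG (norm_nonneg (y - x)) h1 h2
  have hdiff : ∀ z ∈ D, DifferentiableAt ℝ (gradient f) z := fun z hz =>
    (hf.2.1 z hz).differentiableAt (hD.mem_nhds hz)
  have hmem : ∀ s ∈ Set.Icc (0 : ℝ) 1, x + s • (y - x) ∈ D := fun s hs =>
    hxy (segment_eq_image' ℝ x y ▸ ⟨s, hs, rfl⟩)
  have hder : ∀ s ∈ Set.Icc (0 : ℝ) 1, HasDerivAt (fun s : ℝ => gradient f (x + s • (y - x)))
      (fderiv ℝ (gradient f) (x + s • (y - x)) (y - x)) s := by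
    intro s hs
    have h3 : HasDerivAt (fun s : ℝ => x + s • (y - x)) (y - x) s := by
      simpa using ((hasDerivAt_id s).smul_const (y - x)).const_add x
    exact (hdiff _ (hmem s hs)).hasFDerivAt.comp_hasDerivAt s h3
  -- Barrier argument: where the gradient norm touches `A + s A` it is at most `2 A`, so the Hessian
  -- bound is `effL` there and the gradient moves with speed strictly below the slope `A` of the
  -- barrier.
  have hnorm : ∀ s ∈ Set.Icc (0 : ℝ) 1, ‖gradient f (x + s • (y - x))‖ ≤ A + s * A := by
    refine image_norm_le_of_norm_deriv_right_lt_deriv_boundary (B := fun s => A + s * A)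
      (B' := fun _ => A) (fun s hs => (hder s hs).continuousAt.continuousWithinAt)
      (fun s hs => (hder s (Set.Ico_subset_Icc_self hs)).hasDerivWithinAt) ?_ ?_ ?_
    · simp; linarith
    · intro s
      simpa using ((hasDerivAt_id s).mul_const A).const_add A
    · intro s hs heq
      have hs' := Set.Ico_subset_Icc_self hs
      have hb := hf.norm_fderiv_le hD hρ hL₀ hLρ (hmem s hs')
      have hl := hlev _ (norm_nonneg (gradient f (x + s • (y - x))))
        (by rw [heq]; nlinarith [hs'.2])
      calc _ ≤ effL ρ L₀ Lρ G * ‖y - x‖ :=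
            ContinuousLinearMap.le_of_opNorm_le _ (hb.trans hl) _
        _ < A := by rw [mul_comm]; exact hRA
  have hbound : ∀ p ∈ segment ℝ x y, ‖fderiv ℝ (gradient f) p‖ ≤ effL ρ L₀ Lρ G := by
    intro p hp
    have hpD := hxy hp
    rw [segment_eq_image'] at hp
    obtain ⟨s, hs, rfl⟩ := hp
    refine (hf.norm_fderiv_le hD hρ hL₀ hLρ hpD).trans (hlev _ (norm_nonneg _) ?_)
    have := hnorm s hs
    nlinarith [hs.2]
  intro p hp
  exact Convex.norm_image_sub_le_of_norm_hasFDerivWithin_le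
    (fun z hz => (hdiff z (hxy hz)).hasFDerivAt.hasFDerivWithinAt) hbound (convex_segment x y)
    (left_mem_segment ℝ x y) hp

/-- The descent inequality along a segment on which the gradient is Lipschitz at the origin. -/
theorem image_sub_le_inner_gradient_add {d : ℕ} {D : Set (Vec d)} {f : Vec d → ℝ} (hD : IsOpen D)
    (hf : DifferentiableOn ℝ f D) {x y : Vec d} (hxy : segment ℝ x y ⊆ D) {L : ℝ} (hL : 0 ≤ L)
    (hlip : ∀ p ∈ segment ℝ x y, ‖gradient f p - gradient f x‖ ≤ L * ‖p - x‖) :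
    f y - f x ≤ inner ℝ (gradient f x) (y - x) + L * ‖y - x‖ ^ 2 := by
  have hseg : ∀ s ∈ Set.Icc (0 : ℝ) 1, x + s • (y - x) ∈ segment ℝ x y := fun s hs =>
    segment_eq_image' ℝ x y ▸ ⟨s, hs, rfl⟩
  have hder : ∀ s ∈ Set.Icc (0 : ℝ) 1, HasDerivAt (fun s : ℝ => f (x + s • (y - x)))
      (inner ℝ (gradient f (x + s • (y - x))) (y - x)) s := by
    intro s hs
    have h3 : HasDerivAt (fun s : ℝ => x + s • (y - x)) (y - x) s := by
      simpa using ((hasDerivAt_id s).smul_const (y - x)).const_add x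
    have hz := hxy (hseg s hs)
    have h4 := (((hf _ hz).differentiableAt (hD.mem_nhds hz)).hasGradientAt).hasFDerivAt
    exact h4.comp_hasDerivAt s h3
  have hmain := image_le_of_deriv_right_le_deriv_boundary (a := 0) (b := 1)
    (f := fun s : ℝ => f (x + s • (y - x)))
    (B := fun s : ℝ => f x + s * (inner ℝ (gradient f x) (y - x) + L * ‖y - x‖ ^ 2))
    (B' := fun _ => inner ℝ (gradient f x) (y - x) + L * ‖y - x‖ ^ 2)
    (fun s hs => (hder s hs).continuousAt.continuousWithinAt)
    (fun s hs => (hder s (Set.Ico_subset_Icc_self hs)).hasDerivWithinAt) (by simp)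
    (by fun_prop)
    (fun s _ => by
      simpa using (((hasDerivAt_id s).mul_const
        (inner ℝ (gradient f x) (y - x) + L * ‖y - x‖ ^ 2)).const_add (f x)).hasDerivWithinAt)
    (fun s hs => by
      have hs' := Set.Ico_subset_Icc_self hs
      have h5 := hlip _ (hseg s hs')
      rw [add_sub_cancel_left, norm_smul, Real.norm_of_nonneg hs'.1] at h5
      have h6 : inner ℝ (gradient f (x + s • (y - x)) - gradient f x) (y - x)
          ≤ L * ‖y - x‖ ^ 2 := by
        refine (real_inner_le_norm _ _).trans ?_
        -- Bounding `s` by 1 instead of integrating it costs a factor 2 in the quadratic term, which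
        -- is harmless.
        have h7 : L * (s * ‖y - x‖) ≤ L * ‖y - x‖ := by
          gcongr; exact mul_le_of_le_one_left (norm_nonneg _) hs'.2
        nlinarith [norm_nonneg (y - x)]
      rw [inner_sub_left] at h6
      linarith)
  have h8 := hmain (Set.right_mem_Icc.2 zero_le_one)
  simp only [one_smul, add_sub_cancel, one_mul] at h8
  linarith

/-! ### Second moments on product spaces, integrating out one coordinate at a time -/

/-- The second moment of a constant plus a centred bounded vector. -/
theorem lintegral_norm_add_sq_le {d : ℕ} {Ξ : Type*} [MeasurableSpace Ξ] {P : Measure Ξ}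
    [IsProbabilityMeasure P] {W : Ξ → Vec d} (hW : AEStronglyMeasurable W P) {b : ℝ}
    (hb : ∀ᵐ z ∂P, ‖W z‖ ≤ b) (h0 : ∫ z, W z ∂P = 0) (a : Vec d) :
    ∫⁻ z, ENNReal.ofReal (‖a + W z‖ ^ 2) ∂P ≤ ENNReal.ofReal (‖a‖ ^ 2 + b ^ 2) := by
  have hWi : Integrable W P := Integrable.of_bound hW b hb
  have hin : Integrable (fun z => inner ℝ a (W z)) P := hWi.const_inner a
  have hint : Integrable (fun z => ‖a‖ ^ 2 + 2 * inner ℝ a (W z) + b ^ 2) P :=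
    ((integrable_const _).add (hin.const_mul 2)).add (integrable_const _)
  have hle : ∀ᵐ z ∂P, ‖a + W z‖ ^ 2 ≤ ‖a‖ ^ 2 + 2 * inner ℝ a (W z) + b ^ 2 := by
    filter_upwards [hb] with z hz
    rw [norm_add_sq_real]
    have := pow_le_pow_left₀ (norm_nonneg _) hz 2
    linarith
  calc ∫⁻ z, ENNReal.ofReal (‖a + W z‖ ^ 2) ∂P
      ≤ ∫⁻ z, ENNReal.ofReal (‖a‖ ^ 2 + 2 * inner ℝ a (W z) + b ^ 2) ∂P :=
        lintegral_mono_ae (hle.mono fun z hz => ENNReal.ofReal_le_ofReal hz)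
    _ = ENNReal.ofReal (∫ z, (‖a‖ ^ 2 + 2 * inner ℝ a (W z) + b ^ 2) ∂P) :=
        (ofReal_integral_eq_lintegral_ofReal hint
          (hle.mono fun z hz => (sq_nonneg _).trans hz)).symm
    _ = ENNReal.ofReal (‖a‖ ^ 2 + b ^ 2) := by
        congr 1
        have h1 : Integrable (fun z => ‖a‖ ^ 2 + 2 * inner ℝ a (W z)) P :=
          (integrable_const _).add (hin.const_mul 2)
        rw [integral_add h1 (integrable_const _), integral_add (integrable_const _)
          (hin.const_mul 2), integral_const_mul, integral_inner hWi, h0]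
        simp

section Coordinates

variable {ι Ξ : Type*} [Fintype ι] [DecidableEq ι] [MeasurableSpace Ξ] {P : Measure Ξ}
  [IsProbabilityMeasure P]

/-- Comparison of integrals over a finite product by integrating out one coordinate. -/
theorem integral_le_of_lintegral_update_le {ψ φ : (ι → Ξ) → ℝ} (i : ι) (hψ : Measurable ψ)
    (hφ : Measurable φ) (hψ0 : ∀ u, 0 ≤ ψ u) (hφ0 : ∀ u, 0 ≤ φ u)
    (hφi : Integrable φ (Measure.pi fun _ : ι => P))
    (hinv : ∀ u z, φ (Function.update u i z) = φ u)
    (hle : ∀ u, ∫⁻ z, ENNReal.ofReal (ψ (Function.update u i z)) ∂P ≤ ENNReal.ofReal (φ u)) :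
    Integrable ψ (Measure.pi fun _ : ι => P) ∧
      ∫ u, ψ u ∂(Measure.pi fun _ : ι => P) ≤ ∫ u, φ u ∂(Measure.pi fun _ : ι => P) := by
  -- Integrating out coordinate `i` with the others frozen plays the role of conditional
  -- expectation. Working with `∫⁻` lets the integrability of `ψ` come out as a conclusion.
  have h := lintegral_le_of_lmarginal_le (μ := fun _ : ι => P) {i}
    (f := fun u => ENNReal.ofReal (ψ u)) (g := fun u => ENNReal.ofReal (φ u))
    hψ.ennreal_ofReal hφ.ennreal_ofReal (by
      rw [lmarginal_singleton, lmarginal_singleton]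
      intro u
      simp only [hinv, lintegral_const, measure_univ, mul_one]
      exact hle u)
  have hfin : ∫⁻ u, ENNReal.ofReal (φ u) ∂(Measure.pi fun _ : ι => P) < ∞ := by
    rw [← ofReal_integral_eq_lintegral_ofReal hφi (Filter.Eventually.of_forall hφ0)]
    exact ENNReal.ofReal_lt_top
  have hψi : Integrable ψ (Measure.pi fun _ : ι => P) :=
    ⟨hψ.aestronglyMeasurable,
      (hasFiniteIntegral_iff_ofReal (Filter.Eventually.of_forall hψ0)).2 (h.trans_lt hfin)⟩
  refine ⟨hψi, ?_⟩
  rw [← ofReal_integral_eq_lintegral_ofReal hφi (Filter.Eventually.of_forall hφ0),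
    ← ofReal_integral_eq_lintegral_ofReal hψi (Filter.Eventually.of_forall hψ0)] at h
  exact (ENNReal.ofReal_le_ofReal_iff (integral_nonneg hφ0)).1 h

/-- A measurable property of a product that holds almost surely in one coordinate, whatever the
others are, holds almost surely. -/
theorem ae_pi_of_forall_ae_update {p : (ι → Ξ) → Prop} (i : ι) (hp : MeasurableSet {u | p u})
    (h : ∀ u, ∀ᵐ z ∂P, p (Function.update u i z)) : ∀ᵐ u ∂(Measure.pi fun _ : ι => P), p u := by
  have hm : Measurable (Set.indicator {u | p u}ᶜ (fun _ => (1 : ℝ≥0∞))) :=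
    measurable_const.indicator hp.compl
  have hle := lintegral_le_of_lmarginal_le (μ := fun _ : ι => P) {i}
    (f := Set.indicator {u | p u}ᶜ (fun _ => (1 : ℝ≥0∞))) (g := fun _ => 0) hm measurable_const (by
      rw [lmarginal_singleton, lmarginal_singleton]
      intro u
      simp only [lintegral_zero, nonpos_iff_eq_zero]
      refine lintegral_eq_zero_of_ae_eq_zero ?_
      filter_upwards [h u] with z hz
      simp [hz])
  rw [lintegral_indicator hp.compl] at hle
  simpa [ae_iff, Set.compl_ofPred] using hle

/-- The second moment of a sum of independent centred bounded vectors. -/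
theorem integral_norm_sum_sq_le {d S : ℕ} {Y : Ξ → Vec d} (hY : Measurable Y) {σ : ℝ}
    (hb : ∀ᵐ z ∂P, ‖Y z‖ ≤ σ) (h0 : ∫ z, Y z ∂P = 0) {e : Fin S → ι}
    (he : Function.Injective e) (s : Finset (Fin S)) :
    Integrable (fun u : ι → Ξ => ‖∑ j ∈ s, Y (u (e j))‖ ^ 2) (Measure.pi fun _ : ι => P) ∧
      ∫ u, ‖∑ j ∈ s, Y (u (e j))‖ ^ 2 ∂(Measure.pi fun _ : ι => P) ≤ s.card * σ ^ 2 := by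
  have hmeas : ∀ s : Finset (Fin S), Measurable fun u : ι → Ξ => ‖∑ j ∈ s, Y (u (e j))‖ ^ 2 :=
    fun s => ((Finset.measurable_sum s fun j _ =>
      hY.comp (measurable_pi_apply (e j))).norm).pow_const 2
  induction s using Finset.induction_on with
  | empty => simp
  | insert j s hj ih =>
    -- By injectivity of `e`, the coordinate of the new term does not enter the partial sum, which
    -- is therefore the constant `a` of `lintegral_norm_add_sq_le`.
    have hinv : ∀ (u : ι → Ξ) z, ∑ k ∈ s, Y (Function.update u (e j) z (e k))
        = ∑ k ∈ s, Y (u (e k)) := fun u z => Finset.sum_congr rfl fun k hk => by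
      rw [Function.update_of_ne]
      exact fun h => hj (he h ▸ hk)
    have := integral_le_of_lintegral_update_le (P := P) (e j) (hmeas (insert j s))
      ((hmeas s).add_const (σ ^ 2)) (fun u => sq_nonneg _) (fun u => by positivity)
      (ih.1.add (integrable_const _)) (fun u z => by rw [hinv])
      (fun u => by
        simp only [Finset.sum_insert hj, hinv, Function.update_self]
        simp_rw [add_comm (Y _)]
        exact lintegral_norm_add_sq_le hY.aestronglyMeasurable hb h0 _)
    refine ⟨this.1, this.2.trans ?_⟩
    rw [integral_add ih.1 (integrable_const _), Finset.card_insert_of_notMem hj]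
    simp only [integral_const, probReal_univ, one_smul]
    push_cast
    linarith [ih.2]

end Coordinates

/-- Markov's inequality for real integrals. -/
theorem measureReal_ge_le_integral_div {α : Type*} [MeasurableSpace α] {μ : Measure α} {f : α → ℝ}
    (hf : ∀ x, 0 ≤ f x) (hfi : Integrable f μ) {M : ℝ} (hM : 0 < M) :
    μ.real {x | M ≤ f x} ≤ (∫ x, f x ∂μ) / M := by
  rw [le_div_iff₀' hM]
  exact mul_meas_ge_le_integral_of_nonneg (Filter.Eventually.of_forall hf) hfi M

/-! ### Runs driven by an abstract gradient oracle -/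

section OracleRun

variable {d : ℕ} {Ξ : Type*} (γ : Vec d → Ξ → Vec d) (η β βsq lam : ℝ)

/-- VRAdam driven by an arbitrary gradient oracle `γ`: initialization. -/
noncomputable def oracleInit (xinit : Vec d) {S₁ : ℕ} (batch : Fin S₁ → Ξ) : State d :=
  let m₁ : Vec d := (S₁ : ℝ)⁻¹ • ∑ j, γ xinit (batch j)
  { x := xinit
    m := m₁
    v := WithLp.toLp 2 fun i => βsq * m₁ i ^ 2
    next := WithLp.toLp 2 fun i => xinit i - η * m₁ i / (|m₁ i| + lam) }

/-- VRAdam driven by an arbitrary gradient oracle `γ`: update. -/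
noncomputable def oracleStep (t : ℕ) (ξ : Ξ) (s : State d) : State d :=
  let x : Vec d := s.next
  let g : Vec d := γ x ξ
  let m : Vec d := (1 - β) • s.m + β • g + (1 - β) • (g - γ s.x ξ)
  let v : Vec d := WithLp.toLp 2 fun i => (1 - βsq) * s.v i + βsq * g i ^ 2
  let vhat : Vec d := WithLp.toLp 2 fun i => v i / (1 - (1 - βsq) ^ t)
  { x := x
    m := m
    v := v
    next := WithLp.toLp 2 fun i => x i - η / (√(vhat i) + lam) * m i }

/-- VRAdam driven by an arbitrary gradient oracle `γ`: the state at time `k + 1`. -/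
noncomputable def oracleState (xinit : Vec d) {S₁ : ℕ} (batch : Fin S₁ → Ξ) (ξ : ℕ → Ξ) :
    ℕ → State d
  | 0 => oracleInit γ η βsq lam xinit batch
  | k + 1 => oracleStep γ η β βsq lam (k + 2) (ξ (k + 2)) (oracleState xinit batch ξ k)

/-- Making the oracle a parameter allows `sgrad F`, over which there is no control off `D`, to be
exchanged for a jointly measurable extension by zero. -/
theorem state_eq_oracleState (F : Vec d → Ξ → ℝ) (xinit : Vec d) {S₁ : ℕ} (batch : Fin S₁ → Ξ)
    (ξ : ℕ → Ξ) (k : ℕ) : state F η β βsq lam xinit batch ξ k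
      = oracleState (sgrad F) η β βsq lam xinit batch ξ k := by
  induction k with
  | zero => rfl
  | succ k ih => rw [state, oracleState, ← ih]; rfl

variable {γ η β βsq lam}

@[simp] theorem oracleState_zero_x (xinit : Vec d) {S₁ : ℕ} (batch : Fin S₁ → Ξ) (ξ : ℕ → Ξ) :
    (oracleState γ η β βsq lam xinit batch ξ 0).x = xinit := rfl

theorem oracleState_succ_x (xinit : Vec d) {S₁ : ℕ} (batch : Fin S₁ → Ξ) (ξ : ℕ → Ξ) (k : ℕ) :
    (oracleState γ η β βsq lam xinit batch ξ (k + 1)).x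
      = (oracleState γ η β βsq lam xinit batch ξ k).next := rfl

/-- The state at time `k + 1` depends only on the samples drawn up to that time. -/
theorem oracleState_congr_samples (xinit : Vec d) {S₁ : ℕ} {batch batch' : Fin S₁ → Ξ}
    {ξ ξ' : ℕ → Ξ} (hb : ∀ j, batch j = batch' j) (k : ℕ)
    (h : ∀ t, 2 ≤ t → t ≤ k + 1 → ξ t = ξ' t) :
    oracleState γ η β βsq lam xinit batch ξ k
      = oracleState γ η β βsq lam xinit batch' ξ' k := by
  obtain rfl : batch = batch' := funext hb
  induction k with
  | zero => rfl
  | succ k ih =>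
    rw [oracleState, oracleState, ih fun t h2 ht => h t h2 (by omega), h (k + 2) (by omega) le_rfl]

/-- Oracles that agree on `D` produce the same run as long as it stays in `D`. -/
theorem oracleState_congr_oracle {γ' : Vec d → Ξ → Vec d} {D : Set (Vec d)}
    (hγ : ∀ x ∈ D, γ x = γ' x) (xinit : Vec d) {S₁ : ℕ} (batch : Fin S₁ → Ξ) (ξ : ℕ → Ξ) (k : ℕ)
    (h : ∀ j ≤ k, (oracleState γ η β βsq lam xinit batch ξ j).x ∈ D) :
    oracleState γ η β βsq lam xinit batch ξ k
      = oracleState γ' η β βsq lam xinit batch ξ k := by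
  induction k with
  | zero =>
    have h0 := hγ _ (h 0 le_rfl)
    rw [oracleState_zero_x] at h0
    simp only [oracleState, oracleInit, h0]
  | succ k ih =>
    have ih' := ih fun j hj => h j (by omega)
    have h1 := hγ _ (h (k + 1) le_rfl)
    have h2 := hγ _ (h k (by omega))
    rw [oracleState_succ_x] at h1
    rw [ih'] at h1 h2
    rw [oracleState, oracleState, ih']
    simp only [oracleStep, h1, h2]

/-- The components of the run are measurable functions of the samples. -/
theorem measurable_oracleState [MeasurableSpace Ξ] (hγ : Measurable (Function.uncurry γ))
    {A : Type*} [MeasurableSpace A] (xinit : Vec d) {S₁ : ℕ} {batch : A → Fin S₁ → Ξ}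
    {ξ : A → ℕ → Ξ} (hb : ∀ j, Measurable fun u => batch u j) (hξ : ∀ t, Measurable fun u => ξ u t)
    (k : ℕ) :
    Measurable (fun u => (oracleState γ η β βsq lam xinit (batch u) (ξ u) k).x) ∧
    Measurable (fun u => (oracleState γ η β βsq lam xinit (batch u) (ξ u) k).m) ∧
    Measurable (fun u => (oracleState γ η β βsq lam xinit (batch u) (ξ u) k).v) ∧
    Measurable (fun u => (oracleState γ η β βsq lam xinit (batch u) (ξ u) k).next) := by
  have hcoord : ∀ {q : A → Vec d}, Measurable q → ∀ i, Measurable fun u => q u i := by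
    intro q hq i
    exact (measurable_pi_apply i).comp ((WithLp.measurable_ofLp 2 _).comp hq)
  have hmk : ∀ {q : A → Fin d → ℝ}, (∀ i, Measurable fun u => q u i) →
      Measurable fun u => (WithLp.toLp 2 (q u) : Vec d) := by
    intro q hq
    exact (WithLp.measurable_toLp 2 _).comp (measurable_pi_iff.2 hq)
  induction k with
  | zero =>
    have hm : Measurable fun u => (S₁ : ℝ)⁻¹ • ∑ j, γ xinit (batch u j) := by
      have hj : ∀ j, Measurable fun u => γ xinit (batch u j) := fun j =>
        hγ.comp (measurable_const.prodMk (hb j))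
      exact (Finset.measurable_sum Finset.univ fun j _ => hj j).const_smul (S₁ : ℝ)⁻¹
    refine ⟨measurable_const, hm, hmk fun i => ?_, hmk fun i => ?_⟩
    · exact ((hcoord hm i).pow_const 2).const_mul βsq
    · refine measurable_const.sub (((hcoord hm i).const_mul η).div ?_)
      exact Measurable.add_const (measurable_norm.comp (hcoord hm i)) lam
  | succ k ih =>
    obtain ⟨hx, hm, hv, hn⟩ := ih
    have hg := hγ.comp (hn.prodMk (hξ (k + 2)))
    have hg' := hγ.comp (hx.prodMk (hξ (k + 2)))
    have hm' := ((hm.const_smul (1 - β)).add (hg.const_smul β)).add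
      ((hg.sub hg').const_smul (1 - β))
    have hv' : ∀ i, Measurable fun u =>
        (1 - βsq) * (oracleState γ η β βsq lam xinit (batch u) (ξ u) k).v i
        + βsq * (γ (oracleState γ η β βsq lam xinit (batch u) (ξ u) k).next (ξ u (k + 2))) i ^ 2 :=
      fun i => ((hcoord hv i).const_mul _).add (((hcoord hg i).pow_const 2).const_mul _)
    refine ⟨hn, hm', hmk hv', hmk fun i => ?_⟩
    refine (hcoord hn i).sub (Measurable.mul ?_ (hcoord hm' i))
    exact measurable_const.div ((((hv' i).div_const _).sqrt).add_const lam)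

/-- The second momentum is a weighted average of squares of gradient entries. -/
theorem oracleState_v_bounds (hβ0 : 0 ≤ βsq) (hβ1 : βsq ≤ 1) (xinit : Vec d) {S₁ : ℕ}
    (batch : Fin S₁ → Ξ) (ξ : ℕ → Ξ) {B : ℝ} (k : ℕ)
    (h0 : ‖(oracleState γ η β βsq lam xinit batch ξ 0).m‖ ≤ B)
    (h : ∀ j, j + 1 ≤ k →
      ‖γ (oracleState γ η β βsq lam xinit batch ξ (j + 1)).x (ξ (j + 2))‖ ≤ B) (i : Fin d) :
    0 ≤ (oracleState γ η β βsq lam xinit batch ξ k).v i ∧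
      (oracleState γ η β βsq lam xinit batch ξ k).v i ≤ (1 - (1 - βsq) ^ (k + 1)) * B ^ 2 := by
  have hsq : ∀ w : Vec d, ‖w‖ ≤ B → w i ^ 2 ≤ B ^ 2 := by
    intro w hw
    have := (PiLp.norm_apply_le w i).trans hw
    rw [← sq_abs]
    exact pow_le_pow_left₀ (abs_nonneg _) this 2
  induction k with
  | zero =>
    have := hsq _ h0
    change 0 ≤ βsq * (oracleState γ η β βsq lam xinit batch ξ 0).m i ^ 2 ∧
      βsq * (oracleState γ η β βsq lam xinit batch ξ 0).m i ^ 2 ≤ _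
    refine ⟨by positivity, ?_⟩
    simp only [zero_add, pow_one, sub_sub_cancel]
    gcongr
  | succ k ih =>
    obtain ⟨ih1, ih2⟩ := ih fun j hj => h j (by omega)
    have := hsq _ (h k le_rfl)
    change 0 ≤ (1 - βsq) * (oracleState γ η β βsq lam xinit batch ξ k).v i
        + βsq * (γ (oracleState γ η β βsq lam xinit batch ξ (k + 1)).x (ξ (k + 2))) i ^ 2 ∧
      (1 - βsq) * (oracleState γ η β βsq lam xinit batch ξ k).v i
        + βsq * (γ (oracleState γ η β βsq lam xinit batch ξ (k + 1)).x (ξ (k + 2))) i ^ 2 ≤ _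
    have h1 : 0 ≤ 1 - βsq := by linarith
    refine ⟨by positivity, ?_⟩
    -- The weights of the average sum to `1 - (1 - βsq) ^ (k + 1)`, which is exactly what the bias
    -- correction divides by.
    calc _ ≤ (1 - βsq) * ((1 - (1 - βsq) ^ (k + 1)) * B ^ 2) + βsq * B ^ 2 := by gcongr
      _ = _ := by ring

/-- The coordinatewise step sizes of the run lie between `η / (B + λ)` and `η / λ`. -/
theorem oracleState_exists_step_size (hη : 0 < η) (hlam : 0 < lam) (hβ0 : 0 ≤ βsq)
    (hβ1 : βsq ≤ 1) (xinit : Vec d) {S₁ : ℕ}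
    (batch : Fin S₁ → Ξ) (ξ : ℕ → Ξ) {B : ℝ} (k : ℕ)
    (h0 : ‖(oracleState γ η β βsq lam xinit batch ξ 0).m‖ ≤ B)
    (h : ∀ j, j + 1 ≤ k →
      ‖γ (oracleState γ η β βsq lam xinit batch ξ (j + 1)).x (ξ (j + 2))‖ ≤ B) (i : Fin d) :
    ∃ a, η / (B + lam) ≤ a ∧ a ≤ η / lam ∧
      (oracleState γ η β βsq lam xinit batch ξ k).x i
        - (oracleState γ η β βsq lam xinit batch ξ k).next i
        = a * (oracleState γ η β βsq lam xinit batch ξ k).m i := by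
  have hB : 0 ≤ B := (norm_nonneg _).trans h0
  have hstep : ∀ q : ℝ, 0 ≤ q → q ≤ B → η / (B + lam) ≤ η / (q + lam) ∧ η / (q + lam) ≤ η / lam := by
    intro q hq hqB
    constructor
    · gcongr
    · gcongr; linarith
  cases k with
  | zero =>
    have hm := (PiLp.norm_apply_le (oracleState γ η β βsq lam xinit batch ξ 0).m i).trans h0
    rw [Real.norm_eq_abs] at hm
    obtain ⟨h1, h2⟩ := hstep _ (abs_nonneg _) hm
    refine ⟨_, h1, h2, ?_⟩
    change xinit i - (xinit i - η * (oracleState γ η β βsq lam xinit batch ξ 0).m i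
      / (|(oracleState γ η β βsq lam xinit batch ξ 0).m i| + lam)) = _
    ring
  | succ k =>
    obtain ⟨hv0, hv1⟩ := oracleState_v_bounds hβ0 hβ1 xinit batch ξ (k + 1) h0 h i
    set v := (oracleState γ η β βsq lam xinit batch ξ (k + 1)).v i with hv
    have hw : 0 ≤ 1 - (1 - βsq) ^ (k + 2) := by
      have : (1 - βsq) ^ (k + 2) ≤ 1 := pow_le_one₀ (by linarith) (by linarith)
      linarith
    -- For `βsq = 0` the denominator vanishes; the quotient is then 0 and still satisfies the bound.
    have hq : √(v / (1 - (1 - βsq) ^ (k + 2))) ≤ B := by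
      rw [Real.sqrt_le_left hB]
      exact div_le_of_le_mul₀ hw (by positivity) (by rw [mul_comm]; exact hv1)
    obtain ⟨h1, h2⟩ := hstep _ (Real.sqrt_nonneg _) hq
    refine ⟨_, h1, h2, ?_⟩
    change (oracleState γ η β βsq lam xinit batch ξ (k + 1)).x i
      - ((oracleState γ η β βsq lam xinit batch ξ (k + 1)).x i
        - η / (√(v / (1 - (1 - βsq) ^ (k + 2))) + lam)
          * (oracleState γ η β βsq lam xinit batch ξ (k + 1)).m i) = _
    ring

end OracleRun

/-! ### Topology and measurability of the extended oracle -/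

/-- The set of pairs whose segment lies in an open set is open. -/
theorem isOpen_setOf_segment_subset {d : ℕ} {D : Set (Vec d)} (hD : IsOpen D) :
    IsOpen {p : Vec d × Vec d | segment ℝ p.1 p.2 ⊆ D} := by
  rw [isOpen_iff_mem_nhds]
  intro p hp
  -- Tube lemma: the parameter interval is compact, so a condition open at each parameter is open
  -- uniformly in it.
  have key := isCompact_Icc (a := (0 : ℝ)) (b := 1) |>.eventually_forall_of_forall_eventually
    (x₀ := p) (P := fun q s => q.1 + s • (q.2 - q.1) ∈ D) (fun s hs => by
      have hc : Continuous fun w : (Vec d × Vec d) × ℝ => w.1.1 + w.2 • (w.1.2 - w.1.1) := by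
        fun_prop
      refine (hD.preimage hc).mem_nhds ?_
      exact hp (segment_eq_image' ℝ p.1 p.2 ▸ ⟨s, hs, rfl⟩))
  filter_upwards [key] with q hq
  rw [segment_eq_image']
  rintro _ ⟨s, hs, rfl⟩
  exact hq s hs

/-- A function that is continuous in its first argument on an open set `D` and measurable in the
second is jointly measurable once it is extended by zero off `D`. -/
theorem measurable_uncurry_indicator {d : ℕ} {Ξ : Type*} [MeasurableSpace Ξ] {D : Set (Vec d)}
    (hD : IsOpen D) {g : Vec d → Ξ → Vec d} (hc : ∀ z, ContinuousOn (fun x => g x z) D)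
    (hm : ∀ x ∈ D, Measurable (g x)) :
    Measurable (Function.uncurry fun x z => D.indicator (fun y => g y z) x) := by
  have h1 : StronglyMeasurable (Function.uncurry fun (x : D) (z : Ξ) => g x z) :=
    stronglyMeasurable_uncurry_of_continuous_of_stronglyMeasurable
      (fun z => continuousOn_iff_continuous_domRestrict.1 (hc z))
      (fun x => (hm x x.2).stronglyMeasurable)
  have hs : MeasurableSet (D ×ˢ (Set.univ : Set Ξ)) := hD.measurableSet.prod MeasurableSet.univ
  refine measurable_of_restrict_of_restrict_compl hs ?_ ?_
  · have h2 : Measurable fun q : (D ×ˢ (Set.univ : Set Ξ) : Set (Vec d × Ξ)) =>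
        ((⟨q.1.1, q.2.1⟩ : D), q.1.2) :=
      (Measurable.subtype_mk (measurable_fst.comp measurable_subtype_coe)).prodMk
        (measurable_snd.comp measurable_subtype_coe)
    convert h1.measurable.comp h2 using 1
    ext1 q
    exact Set.indicator_of_mem (s := D) (a := q.1.1) q.2.1 fun y => g y q.1.2
  · convert (measurable_const : Measurable fun _ :
      ((D ×ˢ (Set.univ : Set Ξ))ᶜ : Set (Vec d × Ξ)) => (0 : Vec d)) using 1
    ext1 q
    exact Set.indicator_of_notMem (s := D) (a := q.1.1) (fun h => q.2 ⟨h, trivial⟩)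
      fun y => g y q.1.2

/-! ### Good states: one-step descent and one-step variance -/

/-- The standing assumptions on the objective and its stochastic gradients. -/
structure Problem {d : ℕ} {Ξ : Type*} [MeasurableSpace Ξ] (D : Set (Vec d)) (f : Vec d → ℝ)
    (P : Measure Ξ) (F : Vec d → Ξ → ℝ) (ρ σ L₀ Lρ : ℝ) : Prop where
  rho_nonneg : 0 ≤ ρ
  rho_lt_one : ρ < 1
  sigma_nonneg : 0 ≤ σ
  L₀_nonneg : 0 ≤ L₀
  Lρ_nonneg : 0 ≤ Lρ
  isOpen : IsOpen D
  bddBelow : BddBelow (f '' D)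
  smooth : GenSmoothOn D ρ L₀ Lρ f
  smooth_comp : ∀ z, GenSmoothOn D ρ L₀ Lρ fun x => F x z
  measurable_sgrad : ∀ x ∈ D, Measurable (sgrad F x)
  integral_sgrad : ∀ x ∈ D, ∫ z, sgrad F x z ∂P = gradient f x
  noise : ∀ x ∈ D, ∀ᵐ z ∂P, ‖sgrad F x z - gradient f x‖ ≤ σ

/-- The conditions on the step size under which single steps are controlled. -/
structure StepRegime (ρ σ L₀ Lρ lam G η β : ℝ) : Prop where
  G_pos : 0 < G
  lam_pos : 0 < lam
  eta_pos : 0 < η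
  lam_le : 2 * lam ≤ G
  sigma_le : 2 * σ ≤ G
  eta_rho_le : 20 * (η * (Lρ * G ^ ρ)) ≤ lam
  eta_L₀_le : ρ ≠ 0 → L₀ ≠ 0 → 20 * (η * G * (L₀ ^ (ρ - 1) * Lρ) ^ (1 / ρ)) ≤ lam
  eta_effL_le : 8 * (η * effL ρ L₀ Lρ G) ≤ lam
  beta_eq : β * lam ^ 3 = 1600 * effL ρ L₀ Lρ G ^ 2 * G * η ^ 2
  beta_le : β ≤ 1

/-- The gradient of `f`, extended by zero off `D`. -/
noncomputable def gradExt {d : ℕ} (D : Set (Vec d)) (f : Vec d → ℝ) : Vec d → Vec d :=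
  D.indicator (gradient f)

/-- The stochastic gradient, extended by zero off `D`. -/
noncomputable def sgradExt {d : ℕ} {Ξ : Type*} (D : Set (Vec d)) (F : Vec d → Ξ → ℝ) (x : Vec d)
    (z : Ξ) : Vec d :=
  D.indicator (fun y => sgrad F y z) x

/-- A state is good if the gradient and the momentum error are at most `G`, and the next step stays
in `D` and has coordinatewise step sizes in `[η / (2 G), η / λ]`. -/
structure Good {d : ℕ} (D : Set (Vec d)) (f : Vec d → ℝ) (G η lam : ℝ) (s : State d) : Prop where
  segment_subset : segment ℝ s.x s.next ⊆ D
  norm_grad_le : ‖gradExt D f s.x‖ ≤ G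
  norm_err_le : ‖s.m - gradExt D f s.x‖ ≤ G
  step_le : ∀ i, |s.x i - s.next i| ≤ η / lam * |s.m i|
  le_step : ∀ i, η / (2 * G) * s.m i ^ 2 ≤ (s.x i - s.next i) * s.m i

theorem effL_nonneg {ρ L₀ Lρ G : ℝ} (hL₀ : 0 ≤ L₀) (hLρ : 0 ≤ Lρ) (hG : 0 < G) :
    0 ≤ effL ρ L₀ Lρ G := by
  unfold effL; positivity

section

variable {d : ℕ} {Ξ : Type*} [MeasurableSpace Ξ] {D : Set (Vec d)} {f : Vec d → ℝ} {P : Measure Ξ}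
  {F : Vec d → Ξ → ℝ} {ρ σ L₀ Lρ lam G η β : ℝ} {s : State d}

theorem gradExt_of_mem {x : Vec d} (hx : x ∈ D) : gradExt D f x = gradient f x :=
  Set.indicator_of_mem hx _

theorem sgradExt_of_mem {Ξ : Type*} {F : Vec d → Ξ → ℝ} {x : Vec d} (hx : x ∈ D) (z : Ξ) :
    sgradExt D F x z = sgrad F x z :=
  Set.indicator_of_mem hx _

theorem StepRegime.beta_nonneg (hr : StepRegime ρ σ L₀ Lρ lam G η β) : 0 ≤ β := by
  have h := hr.beta_eq
  have hl : 0 < lam ^ 3 := pow_pos hr.lam_pos 3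
  have hG := hr.G_pos
  by_contra! hb
  have : β * lam ^ 3 < 0 := mul_neg_of_neg_of_pos hb hl
  have : 0 ≤ 1600 * effL ρ L₀ Lρ G ^ 2 * G * η ^ 2 := by positivity
  linarith

theorem Good.mem (hs : Good D f G η lam s) : s.x ∈ D :=
  hs.segment_subset (left_mem_segment ℝ _ _)

theorem Good.next_mem (hs : Good D f G η lam s) : s.next ∈ D :=
  hs.segment_subset (right_mem_segment ℝ _ _)

theorem Good.norm_next_sub_le (hs : Good D f G η lam s) (hη : 0 < η) (hlam : 0 < lam) :
    ‖s.next - s.x‖ ≤ η / lam * ‖s.m‖ := by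
  refine le_of_sq_le_sq ?_ (by positivity)
  rw [mul_pow, EuclideanSpace.real_norm_sq_eq, EuclideanSpace.real_norm_sq_eq, Finset.mul_sum]
  refine Finset.sum_le_sum fun i _ => ?_
  have := pow_le_pow_left₀ (abs_nonneg _) (hs.step_le i) 2
  rw [mul_pow, sq_abs, sq_abs] at this
  calc (s.next - s.x) i ^ 2 = (s.x i - s.next i) ^ 2 := by simp; ring
    _ ≤ _ := this

theorem Good.norm_m_le (hs : Good D f G η lam s) : ‖s.m‖ ≤ 2 * G := by
  have := norm_add_le (s.m - gradExt D f s.x) (gradExt D f s.x)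
  rw [sub_add_cancel] at this
  linarith [hs.norm_grad_le, hs.norm_err_le]

/-- Along a good step, the gradient of a smooth function is Lipschitz with constant `effL`. -/
theorem Good.norm_gradient_sub_le (hs : Good D f G η lam s) (hp : Problem D f P F ρ σ L₀ Lρ)
    (hr : StepRegime ρ σ L₀ Lρ lam G η β) {h : Vec d → ℝ} (hh : GenSmoothOn D ρ L₀ Lρ h)
    (hx : ‖gradient h s.x‖ ≤ 2 * G) : ∀ p ∈ segment ℝ s.x s.next,
      ‖gradient h p - gradient h s.x‖ ≤ effL ρ L₀ Lρ G * ‖p - s.x‖ := by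
  have hG := hr.G_pos
  have hl := hr.lam_pos
  have hη := hr.eta_pos
  -- A step has length at most `2 η G / λ` because `‖m‖ ≤ 2 G`. This 2 times the 10 required by
  -- `GenSmoothOn.norm_gradient_sub_le` is the 20 in `StepRegime`.
  have hR : ‖s.next - s.x‖ ≤ 2 * (η * G) / lam := by
    refine (hs.norm_next_sub_le hη hl).trans ?_
    calc η / lam * ‖s.m‖ ≤ η / lam * (2 * G) := by gcongr; exact hs.norm_m_le
      _ = _ := by ring
  refine hh.norm_gradient_sub_le hp.isOpen hp.rho_nonneg hp.rho_lt_one hp.L₀_nonneg hp.Lρ_nonneg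
    hG hs.segment_subset hx ?_ ?_
  · have h0 : 0 ≤ Lρ * G ^ ρ := mul_nonneg hp.Lρ_nonneg (by positivity)
    calc 10 * (‖s.next - s.x‖ * (Lρ * G ^ ρ)) ≤ 10 * (2 * (η * G) / lam * (Lρ * G ^ ρ)) := by gcongr
      _ = 20 * (η * (Lρ * G ^ ρ)) * (G / lam) := by ring
      _ ≤ lam * (G / lam) := by gcongr; exact hr.eta_rho_le
      _ = G := by field_simp
  · intro h1 h2
    have h0 : 0 ≤ (L₀ ^ (ρ - 1) * Lρ) ^ (1 / ρ) := Real.rpow_nonneg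
      (mul_nonneg (Real.rpow_nonneg hp.L₀_nonneg _) hp.Lρ_nonneg) _
    calc 10 * (‖s.next - s.x‖ * (L₀ ^ (ρ - 1) * Lρ) ^ (1 / ρ))
        ≤ 10 * (2 * (η * G) / lam * (L₀ ^ (ρ - 1) * Lρ) ^ (1 / ρ)) := by gcongr
      _ = 20 * (η * G * (L₀ ^ (ρ - 1) * Lρ) ^ (1 / ρ)) / lam := by ring
      _ ≤ lam / lam := by gcongr; exact hr.eta_L₀_le h1 h2
      _ = 1 := by field_simp

theorem Good.norm_gradExt_next_sub_le (hs : Good D f G η lam s) (hp : Problem D f P F ρ σ L₀ Lρ)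
    (hr : StepRegime ρ σ L₀ Lρ lam G η β) :
    ‖gradExt D f s.next - gradExt D f s.x‖ ≤ effL ρ L₀ Lρ G * ‖s.next - s.x‖ := by
  have hG := hr.G_pos
  have h1 := hs.norm_grad_le
  rw [gradExt_of_mem hs.mem] at h1 ⊢
  rw [gradExt_of_mem hs.next_mem]
  exact hs.norm_gradient_sub_le hp hr hp.smooth (by linarith) _ (right_mem_segment ℝ _ _)

/-- The coordinatewise form of the descent inequality. -/
theorem coordinate_descent {L G η lam g m p : ℝ} (hG : 0 < G) (hη : 0 < η) (hlam : 0 < lam)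
    (hL : 0 ≤ L) (hlG : 2 * lam ≤ G) (hle : 8 * (η * L) ≤ lam) (h1 : |p| ≤ η / lam * |m|)
    (h2 : η / (2 * G) * m ^ 2 ≤ p * m) :
    g * (-p) + L * p ^ 2 ≤ -(η / (8 * G)) * g ^ 2 + 3 * η / (4 * lam) * (m - g) ^ 2 := by
  -- The step size is recovered as `p / m`; for `m = 0` also `p = 0`, and any admissible value
  -- serves.
  obtain ⟨a, ha1, ha2, rfl⟩ : ∃ a, η / (2 * G) ≤ a ∧ a ≤ η / lam ∧ p = a * m := by
    rcases eq_or_ne m 0 with rfl | hm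
    · refine ⟨η / lam, ?_, le_rfl, by simpa using h1⟩
      gcongr
      linarith
    · refine ⟨p / m, ?_, ?_, by field_simp⟩
      · refine le_of_mul_le_mul_right (a := m ^ 2) ?_ (by positivity)
        calc _ ≤ p * m := h2
          _ = p / m * m ^ 2 := by field_simp
      · refine (le_abs_self _).trans ?_
        rw [abs_div, div_le_iff₀ (abs_pos.2 hm)]
        exact h1
  have ha : 0 < a := lt_of_lt_of_le (by positivity) ha1
  have hLa : L * a ≤ 1 / 8 := by
    calc L * a ≤ L * (η / lam) := by gcongr
      _ = (8 * (η * L)) / (8 * lam) := by field_simp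
      _ ≤ lam / (8 * lam) := by gcongr
      _ = 1 / 8 := by field_simp
  have e1 : L * (a * m) ^ 2 ≤ 1 / 8 * (a * m ^ 2) := by
    calc L * (a * m) ^ 2 = (L * a) * (a * m ^ 2) := by ring
      _ ≤ _ := by gcongr
  -- In terms of `g` and `m - g`, the right side minus the left is `a` times a positive definite
  -- quadratic form.
  have e2 : g * (-(a * m)) + 1 / 8 * (a * m ^ 2) ≤ -(a / 4) * g ^ 2 + 3 * a / 4 * (m - g) ^ 2 := by
    have : 0 ≤ a * (5 / 8 * g ^ 2 + 3 / 4 * (g * (m - g)) + 5 / 8 * (m - g) ^ 2) := by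
      refine mul_nonneg ha.le ?_
      nlinarith [sq_nonneg (g + (m - g)), sq_nonneg g, sq_nonneg (m - g)]
    linarith
  have e3 : η / (8 * G) * g ^ 2 ≤ a / 4 * g ^ 2 := by
    refine mul_le_mul_of_nonneg_right ?_ (sq_nonneg g)
    calc η / (8 * G) = η / (2 * G) / 4 := by field_simp; norm_num
      _ ≤ a / 4 := by gcongr
  have e4 : 3 * a / 4 * (m - g) ^ 2 ≤ 3 * η / (4 * lam) * (m - g) ^ 2 := by
    refine mul_le_mul_of_nonneg_right ?_ (sq_nonneg _)
    calc 3 * a / 4 = 3 / 4 * a := by ring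
      _ ≤ 3 / 4 * (η / lam) := by gcongr
      _ = 3 * η / (4 * lam) := by field_simp
  linarith

/-- One good step decreases the objective up to the momentum error. -/
theorem Good.descent (hs : Good D f G η lam s) (hp : Problem D f P F ρ σ L₀ Lρ)
    (hr : StepRegime ρ σ L₀ Lρ lam G η β) :
    f s.next - f s.x ≤ -(η / (8 * G)) * ‖gradExt D f s.x‖ ^ 2
      + 3 * η / (4 * lam) * ‖s.m - gradExt D f s.x‖ ^ 2 := by
  have hG := hr.G_pos
  have hL := effL_nonneg (ρ := ρ) hp.L₀_nonneg hp.Lρ_nonneg hG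
  have h1 := hs.norm_grad_le
  rw [gradExt_of_mem hs.mem] at h1 ⊢
  refine (image_sub_le_inner_gradient_add hp.isOpen hp.smooth.1 hs.segment_subset hL
    (hs.norm_gradient_sub_le hp hr hp.smooth (by linarith))).trans ?_
  rw [PiLp.inner_apply, EuclideanSpace.real_norm_sq_eq, EuclideanSpace.real_norm_sq_eq,
    EuclideanSpace.real_norm_sq_eq, Finset.mul_sum, Finset.mul_sum, Finset.mul_sum,
    ← Finset.sum_add_distrib, ← Finset.sum_add_distrib]
  refine Finset.sum_le_sum fun i _ => ?_
  have := coordinate_descent (g := gradient f s.x i) hG hr.eta_pos hr.lam_pos hL hr.lam_le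
    hr.eta_effL_le (hs.step_le i) (hs.le_step i)
  simp only [PiLp.sub_apply, RCLike.inner_apply, conj_trivial]
  calc _ = gradient f s.x i * (-(s.x i - s.next i))
        + effL ρ L₀ Lρ G * (s.x i - s.next i) ^ 2 := by ring
    _ ≤ _ := this

/-- The drift of the gradient in one good step. -/
theorem Good.norm_gradExt_next_le (hs : Good D f G η lam s) (hp : Problem D f P F ρ σ L₀ Lρ)
    (hr : StepRegime ρ σ L₀ Lρ lam G η β) :
    ‖gradExt D f s.next‖ ≤ ‖gradExt D f s.x‖ + effL ρ L₀ Lρ G * η / lam * ‖s.m‖ := by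
  have hL := effL_nonneg (ρ := ρ) hp.L₀_nonneg hp.Lρ_nonneg hr.G_pos
  have h1 := hs.norm_gradExt_next_sub_le hp hr
  have h2 := hs.norm_next_sub_le hr.eta_pos hr.lam_pos
  have h3 := norm_sub_norm_le (gradExt D f s.next) (gradExt D f s.x)
  have h4 : effL ρ L₀ Lρ G * ‖s.next - s.x‖ ≤ effL ρ L₀ Lρ G * (η / lam * ‖s.m‖) := by gcongr
  have h5 : effL ρ L₀ Lρ G * (η / lam * ‖s.m‖) = effL ρ L₀ Lρ G * η / lam * ‖s.m‖ := by ring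
  linarith

theorem Problem.integrable_sgrad [IsProbabilityMeasure P] (hp : Problem D f P F ρ σ L₀ Lρ)
    {x : Vec d} (hx : x ∈ D) : Integrable (sgrad F x) P := by
  refine Integrable.of_bound (hp.measurable_sgrad x hx).aestronglyMeasurable
    (σ + ‖gradient f x‖) ?_
  filter_upwards [hp.noise x hx] with z hz
  have := norm_add_le (sgrad F x z - gradient f x) (gradient f x)
  rw [sub_add_cancel] at this
  linarith

/-- Numerical part of the variance recursion. -/
theorem variance_recursion_bound {L G η lam β σ R e g w : ℝ} (hG : 0 < G) (hlam : 0 < lam)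
    (hη : 0 < η) (hlG : 2 * lam ≤ G) (hβ0 : 0 ≤ β) (hβ1 : β ≤ 1)
    (hβ : β * lam ^ 3 = 1600 * L ^ 2 * G * η ^ 2) (hR0 : 0 ≤ R)
    (hR : R ≤ η / lam * w) (hw0 : 0 ≤ w) (hw : w ≤ g + e) :
    ((1 - β) * e) ^ 2 + (β * σ + 2 * L * R) ^ 2
      ≤ (1 - β / 2) * e ^ 2 + β * lam / (100 * G) * g ^ 2 + 2 * β ^ 2 * σ ^ 2 := by
  have h1 : R ^ 2 ≤ (η / lam) ^ 2 * (2 * (g ^ 2 + e ^ 2)) := by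
    have h2 : w ^ 2 ≤ 2 * (g ^ 2 + e ^ 2) := by
      have := pow_le_pow_left₀ hw0 hw 2
      nlinarith [sq_nonneg (g - e)]
    calc R ^ 2 ≤ (η / lam * w) ^ 2 := pow_le_pow_left₀ hR0 hR 2
      _ = (η / lam) ^ 2 * w ^ 2 := by ring
      _ ≤ _ := by gcongr
  -- This is what the constant 40 in `θ` is for: the movement of the iterate enters with weight `β`
  -- times `λ / (100 G)`. As `λ ≤ G / 2`, its share of the error is at most `β / 200` and is
  -- absorbed in the contraction.
  have hκ : 16 * L ^ 2 * (η / lam) ^ 2 = β * lam / (100 * G) := by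
    field_simp
    linear_combination (-1 : ℝ) * hβ
  have hκ' : β * lam / (100 * G) ≤ β / 200 := by
    rw [div_le_div_iff₀ (by positivity) (by norm_num)]
    nlinarith
  have h3 : (β * σ + 2 * L * R) ^ 2 ≤ 2 * β ^ 2 * σ ^ 2 + 8 * L ^ 2 * R ^ 2 := by
    nlinarith [sq_nonneg (β * σ - 2 * L * R)]
  have h4 : 8 * L ^ 2 * R ^ 2 ≤ β * lam / (100 * G) * (g ^ 2 + e ^ 2) := by
    calc 8 * L ^ 2 * R ^ 2 ≤ 8 * L ^ 2 * ((η / lam) ^ 2 * (2 * (g ^ 2 + e ^ 2))) := by gcongr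
      _ = 16 * L ^ 2 * (η / lam) ^ 2 * (g ^ 2 + e ^ 2) := by ring
      _ = _ := by rw [hκ]
  have h5 : β * lam / (100 * G) * e ^ 2 ≤ β / 200 * e ^ 2 := by gcongr
  have h6 : ((1 - β) * e) ^ 2 ≤ (1 - β) * e ^ 2 := by
    have : (1 - β) * (1 - β) ≤ (1 - β) * 1 :=
      mul_le_mul_of_nonneg_left (by linarith) (by linarith)
    nlinarith [sq_nonneg e]
  nlinarith [mul_nonneg hβ0 (sq_nonneg e)]

/-- The conditional second moment of the momentum error after a good step. -/
theorem Good.lintegral_err_sq_le [IsProbabilityMeasure P] (hs : Good D f G η lam s)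
    (hp : Problem D f P F ρ σ L₀ Lρ) (hr : StepRegime ρ σ L₀ Lρ lam G η β) (βsq : ℝ) (t : ℕ) :
    ∫⁻ z, ENNReal.ofReal (‖(oracleStep (sgradExt D F) η β βsq lam t z s).m
        - gradExt D f s.next‖ ^ 2) ∂P
      ≤ ENNReal.ofReal ((1 - β / 2) * ‖s.m - gradExt D f s.x‖ ^ 2
        + β * lam / (100 * G) * ‖gradExt D f s.x‖ ^ 2 + 2 * β ^ 2 * σ ^ 2) := by
  have hG := hr.G_pos
  have hβ0 := hr.beta_nonneg
  have hβ1 := hr.beta_le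
  have hx := hs.mem
  have hy := hs.next_mem
  set L := effL ρ L₀ Lρ G with hLdef
  have hng := hs.norm_grad_le
  have hm := norm_add_le (gradExt D f s.x) (s.m - gradExt D f s.x)
  rw [add_sub_cancel] at hm
  have hR := hs.norm_next_sub_le hr.eta_pos hr.lam_pos
  have hlipf := hs.norm_gradExt_next_sub_le hp hr
  rw [gradExt_of_mem hx, gradExt_of_mem hy] at *
  set W : Ξ → Vec d := fun z => β • (sgrad F s.next z - gradient f s.next)
    + (1 - β) • ((sgrad F s.next z - sgrad F s.x z) - (gradient f s.next - gradient f s.x)) with hW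
  -- Adding the gradient difference to the momentum leaves only the centred noise `W`: its first
  -- part is of size `β σ`, and its second is proportional to the step length.
  have hdecomp : ∀ z, (oracleStep (sgradExt D F) η β βsq lam t z s).m - gradient f s.next
      = (1 - β) • (s.m - gradient f s.x) + W z := by
    intro z
    simp only [oracleStep, sgradExt_of_mem hx, sgradExt_of_mem hy, hW]
    module
  have hix := hp.integrable_sgrad hx
  have hiy := hp.integrable_sgrad hy
  have hWmeas : AEStronglyMeasurable W P :=
    (((hiy.sub (integrable_const _)).smul β).add
      (((hiy.sub hix).sub (integrable_const _)).smul (1 - β))).aestronglyMeasurable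
  have hW0 : ∫ z, W z ∂P = 0 := by
    have i1 : Integrable (fun z => sgrad F s.next z - gradient f s.next) P :=
      hiy.sub (integrable_const _)
    have i2 : Integrable (fun z => sgrad F s.next z - sgrad F s.x z) P := hiy.sub hix
    have i3 : Integrable (fun z => (sgrad F s.next z - sgrad F s.x z)
      - (gradient f s.next - gradient f s.x)) P := i2.sub (integrable_const _)
    have i4 : Integrable (fun z => β • (sgrad F s.next z - gradient f s.next)) P := i1.smul β
    have i5 : Integrable (fun z => (1 - β) • ((sgrad F s.next z - sgrad F s.x z)
      - (gradient f s.next - gradient f s.x))) P := i3.smul (1 - β)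
    simp only [hW]
    rw [integral_add i4 i5, integral_smul, integral_smul,
      integral_sub hiy (integrable_const _), integral_sub i2 (integrable_const _),
      integral_sub hiy hix, hp.integral_sgrad _ hx, hp.integral_sgrad _ hy]
    simp
  have hWb : ∀ᵐ z ∂P, ‖W z‖ ≤ β * σ + 2 * L * ‖s.next - s.x‖ := by
    filter_upwards [hp.noise _ hx, hp.noise _ hy] with z hzx hzy
    -- Bounded noise at the fixed point `s.x` puts the component's gradient below `G + σ ≤ 2 G`, so
    -- the component is Lipschitz along the step as well.
    have h1 : ‖sgrad F s.x z‖ ≤ 2 * G := by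
      have := norm_add_le (sgrad F s.x z - gradient f s.x) (gradient f s.x)
      rw [sub_add_cancel] at this
      linarith [hr.sigma_le]
    have h2 : ‖sgrad F s.next z - sgrad F s.x z‖ ≤ L * ‖s.next - s.x‖ :=
      hs.norm_gradient_sub_le hp hr (hp.smooth_comp z) h1 _ (right_mem_segment ℝ _ _)
    have h3 : ‖(sgrad F s.next z - sgrad F s.x z) - (gradient f s.next - gradient f s.x)‖
        ≤ 2 * L * ‖s.next - s.x‖ := by
      refine (norm_sub_le _ _).trans ?_
      linarith
    calc ‖W z‖ ≤ ‖β • (sgrad F s.next z - gradient f s.next)‖ + _ := norm_add_le _ _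
      _ ≤ β * σ + 1 * (2 * L * ‖s.next - s.x‖) := by
        rw [norm_smul, norm_smul, Real.norm_of_nonneg hβ0,
          Real.norm_of_nonneg (show 0 ≤ 1 - β by linarith)]
        have : 0 ≤ 2 * L * ‖s.next - s.x‖ := (norm_nonneg _).trans h3
        gcongr
        linarith
      _ = _ := by ring
  simp_rw [hdecomp]
  refine (lintegral_norm_add_sq_le hWmeas hWb hW0 _).trans (ENNReal.ofReal_le_ofReal ?_)
  rw [norm_smul, Real.norm_of_nonneg (show 0 ≤ 1 - β by linarith)]
  exact variance_recursion_bound hG hr.lam_pos hr.eta_pos hr.lam_le hβ0 hβ1 hr.beta_eq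
    (norm_nonneg _) hR (norm_nonneg _) hm

end

/-! ### Pathwise estimates up to the first bad state -/

/-- The squared momentum error of a state. -/
noncomputable def errSq {d : ℕ} (D : Set (Vec d)) (f : Vec d → ℝ) (s : State d) : ℝ :=
  ‖s.m - gradExt D f s.x‖ ^ 2

/-- The squared gradient norm of a state. -/
noncomputable def gradSq {d : ℕ} (D : Set (Vec d)) (f : Vec d → ℝ) (s : State d) : ℝ :=
  ‖gradExt D f s.x‖ ^ 2

open Classical in
/-- The indicator of the event that the first `n` states of a run are good. -/
noncomputable def active {d : ℕ} (D : Set (Vec d)) (f : Vec d → ℝ) (G η lam : ℝ)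
    (s : ℕ → State d) (n : ℕ) : ℝ :=
  if ∀ j < n, Good D f G η lam (s j) then 1 else 0

section Pathwise

variable {d : ℕ} {D : Set (Vec d)} {f : Vec d → ℝ} {ρ σ L₀ Lρ lam G η β : ℝ}
  {s : ℕ → State d}

theorem errSq_nonneg (s : State d) : 0 ≤ errSq D f s := sq_nonneg _

theorem gradSq_nonneg (s : State d) : 0 ≤ gradSq D f s := sq_nonneg _

theorem active_of_forall {n : ℕ} (h : ∀ j < n, Good D f G η lam (s j)) :
    active D f G η lam s n = 1 := if_pos h

theorem active_of_not_forall {n : ℕ} (h : ¬ ∀ j < n, Good D f G η lam (s j)) :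
    active D f G η lam s n = 0 := if_neg h

theorem active_zero : active D f G η lam s 0 = 1 := active_of_forall (by simp)

theorem active_nonneg (n : ℕ) : 0 ≤ active D f G η lam s n := by
  unfold active; split_ifs <;> norm_num

theorem active_succ_le (n : ℕ) : active D f G η lam s (n + 1) ≤ active D f G η lam s n := by
  by_cases h : ∀ j < n + 1, Good D f G η lam (s j)
  · rw [active_of_forall h, active_of_forall fun j hj => h j (by omega)]
  · rw [active_of_not_forall h]; exact active_nonneg n

/-- The index `n + 1` makes the indicator include goodness of state `n` itself. With index `n` the
error at a first bad state would be retained, and no such bound would hold. -/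
theorem active_succ_mul_errSq_le (n : ℕ) :
    active D f G η lam s (n + 1) * errSq D f (s n) ≤ G ^ 2 := by
  by_cases h : ∀ j < n + 1, Good D f G η lam (s j)
  · rw [active_of_forall h, one_mul]
    exact pow_le_pow_left₀ (norm_nonneg _) (h n (by omega)).norm_err_le 2
  · rw [active_of_not_forall h, zero_mul]; positivity

theorem active_succ_mul_gradSq_le (n : ℕ) :
    active D f G η lam s (n + 1) * gradSq D f (s n) ≤ G ^ 2 := by
  by_cases h : ∀ j < n + 1, Good D f G η lam (s j)
  · rw [active_of_forall h, one_mul]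
    exact pow_le_pow_left₀ (norm_nonneg _) (h n (by omega)).norm_grad_le 2
  · rw [active_of_not_forall h, zero_mul]; positivity

variable {Ξ : Type*} [MeasurableSpace Ξ] {P : Measure Ξ} {F : Vec d → Ξ → ℝ}

theorem Problem.sInf_le (hp : Problem D f P F ρ σ L₀ Lρ) {x : Vec d} (hx : x ∈ D) :
    sInf (f '' D) ≤ f x :=
  csInf_le hp.bddBelow ⟨x, hx, rfl⟩

/-- The gradients along the good part of a run are controlled by the initial gap and the momentum
errors. -/
theorem sum_active_gradSq_le (hp : Problem D f P F ρ σ L₀ Lρ)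
    (hr : StepRegime ρ σ L₀ Lρ lam G η β) (hs : ∀ k, (s (k + 1)).x = (s k).next)
    (h0 : (s 0).x ∈ D) (n : ℕ) :
    η / (8 * G) * ∑ k ∈ Finset.range n, active D f G η lam s (k + 1) * gradSq D f (s k)
      ≤ initGap D f (s 0).x
        + 3 * η / (4 * lam) * ∑ k ∈ Finset.range n, active D f G η lam s (k + 1) * errSq D f (s k) := by
  set A : ℕ → ℝ := fun n => η / (8 * G) *
      ∑ k ∈ Finset.range n, active D f G η lam s (k + 1) * gradSq D f (s k)
    - 3 * η / (4 * lam) *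
      ∑ k ∈ Finset.range n, active D f G η lam s (k + 1) * errSq D f (s k) with hA
  -- Two bounds are carried along. The sharp one, by the actual decrease of `f`, lasts while all
  -- states are good; the one by the gap survives the exit, since `A` is frozen afterwards and the
  -- last good step ended in `D`.
  suffices h : A n ≤ initGap D f (s 0).x ∧
      ((∀ j < n, Good D f G η lam (s j)) → A n ≤ f (s 0).x - f (s n).x) by
    have := h.1
    simp only [hA] at this
    linarith
  induction n with
  | zero =>
    simp only [hA, Finset.range_zero, Finset.sum_empty, mul_zero, sub_self]
    have := hp.sInf_le h0
    exact ⟨by unfold initGap; linarith, fun _ => le_rfl⟩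
  | succ n ih =>
    have hsucc : A (n + 1) = A n + active D f G η lam s (n + 1) *
        (η / (8 * G) * gradSq D f (s n) - 3 * η / (4 * lam) * errSq D f (s n)) := by
      simp only [hA, Finset.sum_range_succ]; ring
    by_cases h : ∀ j < n + 1, Good D f G η lam (s j)
    · have hg := h n (by omega)
      have hd := hg.descent hp hr
      have h1 := ih.2 fun j hj => h j (by omega)
      have h2 := hp.sInf_le hg.next_mem
      rw [hsucc, active_of_forall h, one_mul, hs n]
      unfold gradSq errSq initGap
      constructor
      · linarith
      · intro _; linarith
    · rw [hsucc, active_of_not_forall h, zero_mul, add_zero]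
      exact ⟨ih.1, fun h' => absurd h' h⟩

/-- Numerical part of the drift estimate. -/
theorem drift_bound {G q S a b w a' : ℝ} (hG : 0 < G) (hq : 0 ≤ q) (hS : 0 ≤ S) (hw : w ≤ a + b)
    (hw2 : w ≤ 2 * G) (ha : a ≤ G / 2 + q * (2 * G) + q * (3 / G) * S) (ha' : a' ≤ a + q * w) :
    a' ≤ G / 2 + q * (2 * G) + q * (3 / G) * (S + (a ^ 2 + b ^ 2)) := by
  have h3 : 0 ≤ q * (3 / G) * (a ^ 2 + b ^ 2) := by positivity
  rw [mul_add]
  -- From below `G / 2` one step overshoots by at most `q (2 G)`. Above it, `w` is at most `3 / G`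
  -- times the sum of squares, so the step is charged to the sum.
  by_cases hc : a ≤ G / 2
  · have h1 : q * w ≤ q * (2 * G) := mul_le_mul_of_nonneg_left hw2 hq
    have h2 : 0 ≤ q * (3 / G) * S := by positivity
    linarith
  · push Not at hc
    have h1 : w ≤ 3 / G * (a ^ 2 + b ^ 2) := by
      refine hw.trans ?_
      rw [div_mul_eq_mul_div, le_div_iff₀ hG]
      nlinarith [sq_nonneg (b - G / 2), mul_pos hG hG]
    have h2 : q * w ≤ q * (3 / G * (a ^ 2 + b ^ 2)) := mul_le_mul_of_nonneg_left h1 hq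
    linarith

/-- As long as the run is good, the gradient norm drifts away from the level `G / 2` only at the
expense of the sum of squares. -/
theorem norm_gradExt_le_of_good (hp : Problem D f P F ρ σ L₀ Lρ)
    (hr : StepRegime ρ σ L₀ Lρ lam G η β) (hs : ∀ k, (s (k + 1)).x = (s k).next)
    (h0 : 2 * ‖gradExt D f (s 0).x‖ ≤ G) (n : ℕ) (hgood : ∀ j < n, Good D f G η lam (s j)) :
    ‖gradExt D f (s n).x‖ ≤ G / 2 + effL ρ L₀ Lρ G * η / lam * (2 * G)
      + effL ρ L₀ Lρ G * η / lam * (3 / G)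
        * ∑ k ∈ Finset.range n, (gradSq D f (s k) + errSq D f (s k)) := by
  have hG := hr.G_pos
  have hq : 0 ≤ effL ρ L₀ Lρ G * η / lam :=
    div_nonneg (mul_nonneg (effL_nonneg hp.L₀_nonneg hp.Lρ_nonneg hG) hr.eta_pos.le) hr.lam_pos.le
  set q := effL ρ L₀ Lρ G * η / lam
  induction n with
  | zero =>
    have : 0 ≤ q * (2 * G) := by positivity
    simp only [Finset.range_zero, Finset.sum_empty, mul_zero, add_zero]
    linarith
  | succ n ih =>
    have ih' := ih fun j hj => hgood j (by omega)
    have hg := hgood n (by omega)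
    have hS : 0 ≤ ∑ k ∈ Finset.range n, (gradSq D f (s k) + errSq D f (s k)) :=
      Finset.sum_nonneg fun k _ => add_nonneg (gradSq_nonneg _) (errSq_nonneg _)
    have hm := norm_add_le (gradExt D f (s n).x) ((s n).m - gradExt D f (s n).x)
    rw [add_sub_cancel] at hm
    rw [hs n, Finset.sum_range_succ]
    exact drift_bound hG hq hS hm hg.norm_m_le ih' (hg.norm_gradExt_next_le hp hr)

/-- A run whose momentum errors and sum of squares stay small consists of good states. -/
theorem forall_good (hp : Problem D f P F ρ σ L₀ Lρ) (hr : StepRegime ρ σ L₀ Lρ lam G η β)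
    (hL : 0 < effL ρ L₀ Lρ G) (hs : ∀ k, (s (k + 1)).x = (s k).next)
    (h0 : 2 * ‖gradExt D f (s 0).x‖ ≤ G) {N : ℕ}
    (hseg : ∀ k ≤ N, segment ℝ (s k).x (s k).next ⊆ D)
    (hstep : ∀ k ≤ N, (∀ j ≤ k, ‖gradExt D f (s j).x‖ ≤ G) →
      ∀ i, ∃ a, η / (2 * G) ≤ a ∧ a ≤ η / lam ∧ (s k).x i - (s k).next i = a * (s k).m i)
    (herr : ∀ k ≤ N, (∀ j < k, Good D f G η lam (s j)) → errSq D f (s k) ≤ G ^ 2)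
    (hsum : N ≠ 0 → ∑ k ∈ Finset.range (N + 1), active D f G η lam s (k + 1)
      * (gradSq D f (s k) + errSq D f (s k)) ≤ lam * G ^ 2 / (12 * effL ρ L₀ Lρ G * η)) :
    ∀ k ≤ N, Good D f G η lam (s k) := by
  intro k
  induction k using Nat.strong_induction_on with
  | _ k ih =>
  intro hk
  have hgood : ∀ j < k, Good D f G η lam (s j) := fun j hj => ih j hj (by omega)
  have hG := hr.G_pos
  have hη := hr.eta_pos
  have hl := hr.lam_pos
  -- The budget is `G / 2 + G / 4 + G / 4`: the starting level, one overshoot (`L η / λ ≤ 1 / 8`),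
  -- and the accumulated drift, for which the threshold in `hsum` is calibrated.
  have hgrad : ‖gradExt D f (s k).x‖ ≤ G := by
    rcases Nat.eq_zero_or_pos k with rfl | hkpos
    · linarith [norm_nonneg (gradExt D f (s 0).x)]
    · have h1 := norm_gradExt_le_of_good hp hr hs h0 k hgood
      have h2 : ∑ j ∈ Finset.range k, (gradSq D f (s j) + errSq D f (s j))
          ≤ lam * G ^ 2 / (12 * effL ρ L₀ Lρ G * η) := by
        refine le_trans ?_ (hsum (by omega))
        calc ∑ j ∈ Finset.range k, (gradSq D f (s j) + errSq D f (s j))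
            = ∑ j ∈ Finset.range k, active D f G η lam s (j + 1)
              * (gradSq D f (s j) + errSq D f (s j)) := by
              refine Finset.sum_congr rfl fun j hj => ?_
              rw [Finset.mem_range] at hj
              rw [active_of_forall fun i hi => hgood i (by omega), one_mul]
          _ ≤ _ := Finset.sum_le_sum_of_subset_of_nonneg
              (Finset.range_subset_range.2 (by omega)) fun j _ _ =>
              mul_nonneg (active_nonneg _) (add_nonneg (gradSq_nonneg _) (errSq_nonneg _))
      have h3 : effL ρ L₀ Lρ G * η / lam * (3 / G)
          * ∑ j ∈ Finset.range k, (gradSq D f (s j) + errSq D f (s j)) ≤ G / 4 := by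
        calc _ ≤ effL ρ L₀ Lρ G * η / lam * (3 / G)
              * (lam * G ^ 2 / (12 * effL ρ L₀ Lρ G * η)) := by gcongr
          _ = G / 4 := by field_simp; norm_num
      have h4 : effL ρ L₀ Lρ G * η / lam * (2 * G) ≤ 1 / 8 * (2 * G) := by
        refine mul_le_mul_of_nonneg_right ?_ (by positivity)
        rw [div_le_iff₀ hl]
        linarith [hr.eta_effL_le]
      linarith
  have hst := hstep k hk fun j hj => by
    rcases hj.lt_or_eq with hj | rfl
    · exact (hgood j hj).norm_grad_le
    · exact hgrad
  refine ⟨hseg k hk, hgrad, ?_, fun i => ?_, fun i => ?_⟩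
  · exact le_of_sq_le_sq (herr k hk hgood) hG.le
  · obtain ⟨a, ha1, ha2, ha⟩ := hst i
    have ha0 : 0 ≤ a := le_trans (by positivity) ha1
    rw [ha, abs_mul, abs_of_nonneg ha0]
    gcongr
  · obtain ⟨a, ha1, ha2, ha⟩ := hst i
    rw [ha]
    calc η / (2 * G) * (s k).m i ^ 2 ≤ a * (s k).m i ^ 2 := by gcongr
      _ = _ := by ring

end Pathwise

/-! ### Measurability of the stopped quantities -/

section Measurability

variable {d : ℕ} {D : Set (Vec d)} {f : Vec d → ℝ} {ρ σ L₀ Lρ lam G η β : ℝ}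
  {Ξ : Type*} [MeasurableSpace Ξ] {P : Measure Ξ} {F : Vec d → Ξ → ℝ}

theorem Problem.measurable_gradExt (hp : Problem D f P F ρ σ L₀ Lρ) :
    Measurable (gradExt D f) := by
  have h := measurable_uncurry_indicator (Ξ := Unit) hp.isOpen (g := fun x _ => gradient f x)
    (fun _ => hp.smooth.2.1.continuousOn) (fun _ _ => measurable_const)
  exact h.comp (measurable_id.prodMk (measurable_const (a := ())))

theorem Problem.measurable_sgradExt (hp : Problem D f P F ρ σ L₀ Lρ) :
    Measurable (Function.uncurry (sgradExt D F)) :=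
  measurable_uncurry_indicator hp.isOpen (fun z => (hp.smooth_comp z).2.1.continuousOn)
    hp.measurable_sgrad

variable {A : Type*} [MeasurableSpace A] {X : A → State d}

theorem measurable_errSq (hp : Problem D f P F ρ σ L₀ Lρ) (hx : Measurable fun u => (X u).x)
    (hm : Measurable fun u => (X u).m) : Measurable fun u => errSq D f (X u) :=
  ((hm.sub (hp.measurable_gradExt.comp hx)).norm).pow_const 2

theorem measurable_gradSq (hp : Problem D f P F ρ σ L₀ Lρ) (hx : Measurable fun u => (X u).x) :
    Measurable fun u => gradSq D f (X u) :=
  ((hp.measurable_gradExt.comp hx).norm).pow_const 2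

theorem measurableSet_good (hp : Problem D f P F ρ σ L₀ Lρ) (hx : Measurable fun u => (X u).x)
    (hm : Measurable fun u => (X u).m) (hn : Measurable fun u => (X u).next) :
    MeasurableSet {u | Good D f G η lam (X u)} := by
  have hcoord : ∀ {q : A → Vec d}, Measurable q → ∀ i, Measurable fun u => q u i := by
    intro q hq i
    exact (measurable_pi_apply i).comp ((WithLp.measurable_ofLp 2 _).comp hq)
  have hg := hp.measurable_gradExt.comp hx
  have h1 : MeasurableSet {u | segment ℝ (X u).x (X u).next ⊆ D} :=
    (hx.prodMk hn) (isOpen_setOf_segment_subset hp.isOpen).measurableSet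
  have h2 : MeasurableSet {u | ‖gradExt D f (X u).x‖ ≤ G} := measurableSet_le hg.norm measurable_const
  have h3 : MeasurableSet {u | ‖(X u).m - gradExt D f (X u).x‖ ≤ G} :=
    measurableSet_le (hm.sub hg).norm measurable_const
  have h4 : MeasurableSet {u | ∀ i, |(X u).x i - (X u).next i| ≤ η / lam * |(X u).m i|} := by
    simp only [Set.ofPred_forall]
    exact MeasurableSet.iInter fun i => measurableSet_le
      (measurable_norm.comp ((hcoord hx i).sub (hcoord hn i)))
      ((measurable_norm.comp (hcoord hm i)).const_mul _)
  have h5 : MeasurableSet {u | ∀ i, η / (2 * G) * (X u).m i ^ 2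
      ≤ ((X u).x i - (X u).next i) * (X u).m i} := by
    simp only [Set.ofPred_forall]
    exact MeasurableSet.iInter fun i => measurableSet_le
      (((hcoord hm i).pow_const 2).const_mul _) (((hcoord hx i).sub (hcoord hn i)).mul (hcoord hm i))
  convert (h1.inter h2).inter ((h3.inter h4).inter h5) using 1
  ext u
  exact ⟨fun h => ⟨⟨h.1, h.2⟩, ⟨h.3, h.4⟩, h.5⟩, fun h => ⟨h.1.1, h.1.2, h.2.1.1, h.2.1.2, h.2.2⟩⟩

theorem measurable_active {X : A → ℕ → State d} (hp : Problem D f P F ρ σ L₀ Lρ)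
    (hx : ∀ k, Measurable fun u => (X u k).x)
    (hm : ∀ k, Measurable fun u => (X u k).m) (hn : ∀ k, Measurable fun u => (X u k).next) (n : ℕ) :
    Measurable fun u => active D f G η lam (X u) n := by
  refine Measurable.ite ?_ measurable_const measurable_const
  have : {u | ∀ j < n, Good D f G η lam (X u j)} = ⋂ j, ⋂ (_ : j < n),
      {u | Good D f G η lam (X u j)} := by
    ext u; simp
  rw [this]
  exact MeasurableSet.iInter fun j => MeasurableSet.iInter fun _ =>
    measurableSet_good hp (hx j) (hm j) (hn j)

end Measurability

/-! ### The run on the product space and its variance recursion in expectation -/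

/-- The samples of a run are drawn from distinct coordinates: `e` lists the coordinates of the
batch, and `τ t` is the coordinate of the sample drawn at time `t`. -/
structure DistinctCoordinates {ι : Type*} {S₁ : ℕ} (e : Fin S₁ → ι) (τ : ℕ → ι) (T : ℕ) : Prop where
  injective : Function.Injective e
  batch_ne : ∀ j t, 2 ≤ t → t ≤ T → e j ≠ τ t
  sample_ne : ∀ t t', 2 ≤ t → t < t' → t' ≤ T → τ t ≠ τ t'

/-- The run of VRAdam with the extended oracle, as a function on the product space. -/
noncomputable def run {d : ℕ} {Ξ ι : Type*} (D : Set (Vec d)) (F : Vec d → Ξ → ℝ)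
    (η β βsq lam : ℝ) (x₁ : Vec d) {S₁ : ℕ} (e : Fin S₁ → ι) (τ : ℕ → ι) (u : ι → Ξ) :
    ℕ → State d :=
  oracleState (sgradExt D F) η β βsq lam x₁ (fun j => u (e j)) (fun t => u (τ t))

/-- Summation of the variance recursion. -/
theorem sum_variance_recursion {a b c : ℕ → ℝ} {β κ w : ℝ} {N : ℕ} (hβ : β ≤ 1)
    (hκ : 0 ≤ κ) (hb : ∀ k, 0 ≤ b k) (hc : ∀ k, 0 ≤ c k)
    (h : ∀ k < N, a (k + 1) ≤ (1 - β / 2) * b k + κ * c k + w) :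
    ∑ k ∈ Finset.range (N + 1), (a k - b k) + β / 2 * ∑ k ∈ Finset.range (N + 1), b k
      ≤ a 0 + N * w + κ * ∑ k ∈ Finset.range (N + 1), c k := by
  -- In the application `a k - b k` is the expected squared error lost by stopping at state `k`. The
  -- full term `b n` is kept for the next step of the induction, and at the end pays for its own `β
  -- / 2` share.
  have key : ∀ n ≤ N, ∑ k ∈ Finset.range (n + 1), (a k - b k) + b n
      + β / 2 * ∑ k ∈ Finset.range n, b k ≤ a 0 + n * w + κ * ∑ k ∈ Finset.range n, c k := by
    intro n
    induction n with
    | zero => intro _; simp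
    | succ n ih =>
      intro hn
      have h1 := ih (by omega)
      have h2 := h n (by omega)
      rw [Finset.sum_range_succ _ (n + 1), Finset.sum_range_succ b, Finset.sum_range_succ c]
      push_cast
      linarith
  have h1 := key N le_rfl
  rw [Finset.sum_range_succ b, Finset.sum_range_succ c]
  have h2 : β / 2 * b N ≤ 1 * b N := mul_le_mul_of_nonneg_right (by linarith) (hb N)
  have h3 := mul_nonneg hκ (hc N)
  linarith

section Expectation

variable {d : ℕ} {D : Set (Vec d)} {f : Vec d → ℝ} {ρ σ L₀ Lρ lam G η β βsq : ℝ}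
  {Ξ : Type*} {F : Vec d → Ξ → ℝ} {x₁ : Vec d} {S₁ N : ℕ}
  {ι : Type*} {e : Fin S₁ → ι} {τ : ℕ → ι}

/-- Adaptedness: index `j` means time `j + 1`, so a state with `j ≤ k` uses samples up to time `k +
1` and ignores the one drawn at time `k + 2`. -/
theorem run_update [DecidableEq ι] (hc : DistinctCoordinates e τ (N + 1)) {k j : ℕ} (hk : k < N)
    (hj : j ≤ k) (u : ι → Ξ) (z : Ξ) :
    run D F η β βsq lam x₁ e τ (Function.update u (τ (k + 2)) z) j
      = run D F η β βsq lam x₁ e τ u j := by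
  refine oracleState_congr_samples x₁ (fun i => ?_) j fun t h2 ht => ?_
  · exact Function.update_of_ne (hc.batch_ne i (k + 2) (by omega) (by omega)) _ _
  · exact Function.update_of_ne (hc.sample_ne t (k + 2) h2 (by omega) (by omega)) _ _

/-- With the past frozen, the next state is a single step in the fresh sample, so that one-step
integrals over `P` act as conditional expectations. -/
theorem run_succ_update [DecidableEq ι] (hc : DistinctCoordinates e τ (N + 1)) {k : ℕ} (hk : k < N)
    (u : ι → Ξ) (z : Ξ) :
    run D F η β βsq lam x₁ e τ (Function.update u (τ (k + 2)) z) (k + 1)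
      = oracleStep (sgradExt D F) η β βsq lam (k + 2) z (run D F η β βsq lam x₁ e τ u k) := by
  rw [← run_update hc hk le_rfl u z]
  change oracleStep _ _ _ _ _ _ (Function.update u (τ (k + 2)) z (τ (k + 2))) _ = _
  rw [Function.update_self]
  rfl

theorem active_run_update [DecidableEq ι] (hc : DistinctCoordinates e τ (N + 1)) {k : ℕ}
    (hk : k < N) (u : ι → Ξ) (z : Ξ) :
    active D f G η lam (run D F η β βsq lam x₁ e τ (Function.update u (τ (k + 2)) z)) (k + 1)
      = active D f G η lam (run D F η β βsq lam x₁ e τ u) (k + 1) := by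
  unfold active
  congr 1
  refine propext (forall_congr' fun j => forall_congr' fun hj => ?_)
  rw [run_update hc hk (by omega)]

theorem run_zero_m_sub (hx₁ : x₁ ∈ D) (hS : S₁ ≠ 0) (u : ι → Ξ) :
    (run D F η β βsq lam x₁ e τ u 0).m - gradExt D f x₁
      = (S₁ : ℝ)⁻¹ • ∑ j, (sgrad F x₁ (u (e j)) - gradient f x₁) := by
  have hS' : (S₁ : ℝ) ≠ 0 := Nat.cast_ne_zero.2 hS
  change (S₁ : ℝ)⁻¹ • ∑ j, sgradExt D F x₁ (u (e j)) - _ = _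
  simp only [sgradExt_of_mem hx₁, gradExt_of_mem hx₁, Finset.sum_sub_distrib, Finset.sum_const,
    Finset.card_univ, Fintype.card_fin, smul_sub]
  rw [← Nat.cast_smul_eq_nsmul ℝ, smul_smul, inv_mul_cancel₀ hS', one_smul]

variable [MeasurableSpace Ξ] {P : Measure Ξ}

theorem measurable_run (hp : Problem D f P F ρ σ L₀ Lρ) (k : ℕ) :
    Measurable (fun u : ι → Ξ => (run D F η β βsq lam x₁ e τ u k).x) ∧
    Measurable (fun u : ι → Ξ => (run D F η β βsq lam x₁ e τ u k).m) ∧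
    Measurable (fun u : ι → Ξ => (run D F η β βsq lam x₁ e τ u k).v) ∧
    Measurable (fun u : ι → Ξ => (run D F η β βsq lam x₁ e τ u k).next) :=
  measurable_oracleState hp.measurable_sgradExt x₁ (fun _ => measurable_pi_apply _)
    (fun _ => measurable_pi_apply _) k

theorem measurable_active_run (hp : Problem D f P F ρ σ L₀ Lρ) (n : ℕ) :
    Measurable fun u : ι → Ξ => active D f G η lam (run D F η β βsq lam x₁ e τ u) n :=
  measurable_active hp (fun k => (measurable_run hp k).1) (fun k => (measurable_run hp k).2.1)
    (fun k => (measurable_run hp k).2.2.2) n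

theorem measurable_errSq_run (hp : Problem D f P F ρ σ L₀ Lρ) (k : ℕ) :
    Measurable fun u : ι → Ξ => errSq D f (run D F η β βsq lam x₁ e τ u k) :=
  measurable_errSq hp (measurable_run hp k).1 (measurable_run hp k).2.1

theorem measurable_gradSq_run (hp : Problem D f P F ρ σ L₀ Lρ) (k : ℕ) :
    Measurable fun u : ι → Ξ => gradSq D f (run D F η β βsq lam x₁ e τ u k) :=
  measurable_gradSq hp (measurable_run hp k).1

variable [Fintype ι] [IsProbabilityMeasure P]

theorem integrable_active_errSq (hp : Problem D f P F ρ σ L₀ Lρ) (k : ℕ) :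
    Integrable (fun u : ι → Ξ => active D f G η lam (run D F η β βsq lam x₁ e τ u) (k + 1)
      * errSq D f (run D F η β βsq lam x₁ e τ u k)) (Measure.pi fun _ => P) := by
  refine Integrable.of_bound ((measurable_active_run hp (k + 1)).mul
    (measurable_errSq_run hp k)).aestronglyMeasurable (G ^ 2) (Filter.Eventually.of_forall fun u => ?_)
  rw [Real.norm_of_nonneg (mul_nonneg (active_nonneg _) (errSq_nonneg _))]
  exact active_succ_mul_errSq_le k

theorem integrable_active_gradSq (hp : Problem D f P F ρ σ L₀ Lρ) (k : ℕ) :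
    Integrable (fun u : ι → Ξ => active D f G η lam (run D F η β βsq lam x₁ e τ u) (k + 1)
      * gradSq D f (run D F η β βsq lam x₁ e τ u k)) (Measure.pi fun _ => P) := by
  refine Integrable.of_bound ((measurable_active_run hp (k + 1)).mul
    (measurable_gradSq_run hp k)).aestronglyMeasurable (G ^ 2) (Filter.Eventually.of_forall fun u => ?_)
  rw [Real.norm_of_nonneg (mul_nonneg (active_nonneg _) (gradSq_nonneg _))]
  exact active_succ_mul_gradSq_le k

variable [DecidableEq ι]

/-- The variance of the initial momentum. -/
theorem integral_errSq_zero_le (hp : Problem D f P F ρ σ L₀ Lρ) (hx₁ : x₁ ∈ D) (hS : S₁ ≠ 0)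
    (hc : DistinctCoordinates e τ (N + 1)) :
    Integrable (fun u : ι → Ξ => active D f G η lam (run D F η β βsq lam x₁ e τ u) 0
      * errSq D f (run D F η β βsq lam x₁ e τ u 0)) (Measure.pi fun _ => P) ∧
    ∫ u : ι → Ξ, active D f G η lam (run D F η β βsq lam x₁ e τ u) 0
      * errSq D f (run D F η β βsq lam x₁ e τ u 0) ∂(Measure.pi fun _ => P) ≤ σ ^ 2 / S₁ := by
  have hS' : (S₁ : ℝ) ≠ 0 := Nat.cast_ne_zero.2 hS
  have hY : Measurable fun z => sgrad F x₁ z - gradient f x₁ :=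
    (hp.measurable_sgrad x₁ hx₁).sub_const _
  have hY0 : ∫ z, (sgrad F x₁ z - gradient f x₁) ∂P = 0 := by
    rw [integral_sub (hp.integrable_sgrad hx₁) (integrable_const _), hp.integral_sgrad _ hx₁]
    simp
  obtain ⟨h1, h2⟩ := integral_norm_sum_sq_le hY (hp.noise x₁ hx₁) hY0 hc.injective Finset.univ
  have heq : (fun u : ι → Ξ => active D f G η lam (run D F η β βsq lam x₁ e τ u) 0
      * errSq D f (run D F η β βsq lam x₁ e τ u 0))
      = fun u => ((S₁ : ℝ)⁻¹) ^ 2 * ‖∑ j, (sgrad F x₁ (u (e j)) - gradient f x₁)‖ ^ 2 := by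
    funext u
    have := run_zero_m_sub (f := f) (F := F) (η := η) (β := β) (βsq := βsq) (lam := lam) (e := e)
      (τ := τ) hx₁ hS u
    rw [active_zero, one_mul, errSq]
    change ‖_ - gradExt D f x₁‖ ^ 2 = _
    rw [this, norm_smul, mul_pow, Real.norm_of_nonneg (by positivity)]
  rw [heq]
  refine ⟨h1.const_mul _, ?_⟩
  rw [integral_const_mul]
  rw [Finset.card_univ, Fintype.card_fin] at h2
  calc _ ≤ ((S₁ : ℝ)⁻¹) ^ 2 * (S₁ * σ ^ 2) := by gcongr
    _ = σ ^ 2 / S₁ := by field_simp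

/-- The variance recursion in expectation. -/
theorem integral_errSq_succ_le (hp : Problem D f P F ρ σ L₀ Lρ)
    (hr : StepRegime ρ σ L₀ Lρ lam G η β) (hc : DistinctCoordinates e τ (N + 1)) {k : ℕ}
    (hk : k < N) :
    Integrable (fun u : ι → Ξ => active D f G η lam (run D F η β βsq lam x₁ e τ u) (k + 1)
      * errSq D f (run D F η β βsq lam x₁ e τ u (k + 1))) (Measure.pi fun _ => P) ∧
    ∫ u : ι → Ξ, active D f G η lam (run D F η β βsq lam x₁ e τ u) (k + 1)
        * errSq D f (run D F η β βsq lam x₁ e τ u (k + 1)) ∂(Measure.pi fun _ => P)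
      ≤ (1 - β / 2) * ∫ u : ι → Ξ, active D f G η lam (run D F η β βsq lam x₁ e τ u) (k + 1)
          * errSq D f (run D F η β βsq lam x₁ e τ u k) ∂(Measure.pi fun _ => P)
        + β * lam / (100 * G)
          * ∫ u : ι → Ξ, active D f G η lam (run D F η β βsq lam x₁ e τ u) (k + 1)
            * gradSq D f (run D F η β βsq lam x₁ e τ u k) ∂(Measure.pi fun _ => P)
        + 2 * β ^ 2 * σ ^ 2 := by
  have hG := hr.G_pos
  have hl := hr.lam_pos
  have hβ0 := hr.beta_nonneg
  have hβ1 : 0 ≤ 1 - β / 2 := by linarith [hr.beta_le]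
  have hbi := integrable_active_errSq (G := G) (η := η) (β := β) (βsq := βsq) (lam := lam)
    (x₁ := x₁) (e := e) (τ := τ) hp k
  have hgi := integrable_active_gradSq (G := G) (η := η) (β := β) (βsq := βsq) (lam := lam)
    (x₁ := x₁) (e := e) (τ := τ) hp k
  set X : (ι → Ξ) → ℕ → State d := fun u => run D F η β βsq lam x₁ e τ u with hX
  set B : (ι → Ξ) → ℝ := fun u => active D f G η lam (X u) (k + 1) * errSq D f (X u k) with hB
  set A : (ι → Ξ) → ℝ := fun u => active D f G η lam (X u) (k + 1) * gradSq D f (X u k) with hA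
  have hB0 : ∀ u, 0 ≤ B u := fun u => mul_nonneg (active_nonneg _) (errSq_nonneg _)
  have hA0 : ∀ u, 0 ≤ A u := fun u => mul_nonneg (active_nonneg _) (gradSq_nonneg _)
  have hBm : Measurable B := (measurable_active_run hp (k + 1)).mul (measurable_errSq_run hp k)
  have hAm : Measurable A := (measurable_active_run hp (k + 1)).mul (measurable_gradSq_run hp k)
  have hi1 : Integrable (fun u => (1 - β / 2) * B u + β * lam / (100 * G) * A u)
      (Measure.pi fun _ => P) := (hbi.const_mul _).add (hgi.const_mul _)
  have hmain := integral_le_of_lintegral_update_le (P := P) (τ (k + 2))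
    (ψ := fun u => active D f G η lam (X u) (k + 1) * errSq D f (X u (k + 1)))
    (φ := fun u => (1 - β / 2) * B u + β * lam / (100 * G) * A u + 2 * β ^ 2 * σ ^ 2)
    ((measurable_active_run hp (k + 1)).mul (measurable_errSq_run hp (k + 1)))
    (((hBm.const_mul _).add (hAm.const_mul _)).add_const _)
    (fun u => mul_nonneg (active_nonneg _) (errSq_nonneg _))
    (fun u => by
      have := hB0 u
      have := hA0 u
      positivity)
    (hi1.add (integrable_const _))
    (fun u z => by
      simp only [hB, hA, hX, active_run_update hc hk, run_update hc hk le_rfl])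
    (fun u => by
      simp only [hX, active_run_update hc hk, run_succ_update hc hk]
      -- The indicator depends only on the past. Where it is 1 the one-step estimate applies; where
      -- it is 0 the left side vanishes.
      by_cases hgood : ∀ j < k + 1, Good D f G η lam (X u j)
      · have hg : Good D f G η lam (X u k) := hgood k (by omega)
        simp only [hB, hA]
        rw [active_of_forall hgood]
        simp only [one_mul]
        exact hg.lintegral_err_sq_le hp hr βsq (k + 2)
      · rw [active_of_not_forall hgood]
        simp)
  refine ⟨hmain.1, hmain.2.trans (le_of_eq ?_)⟩
  rw [integral_add hi1 (integrable_const _), integral_add (hbi.const_mul _) (hgi.const_mul _),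
    integral_const_mul, integral_const_mul]
  simp

end Expectation

/-! ### Closing the loop: expected sums, exit probabilities, exceptional set -/

/-- The bound on the expected sum of squared gradients that yields the convergence rate. -/
theorem expected_gradSq_bound {δ ε G lam η L Δ β σ T Y B S : ℝ} (hG : 0 < G) (hlam : 0 < lam)
    (hη : 0 < η) (hΔ : 0 < Δ) (hβ0 : 0 < β) (hY : 0 ≤ Y)
    (h1 : Y + β / 2 * B ≤ 4 * T * β ^ 2 * σ ^ 2 + β * lam / (100 * G) * S)
    (h2 : η / (8 * G) * S ≤ Δ + 3 * η / (4 * lam) * B)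
    (hβ : β * lam ^ 3 = 1600 * L ^ 2 * G * η ^ 2) (hT : 0 ≤ T)
    (hσ : (η * (σ * G * L)) ^ 2 ≤ (1 / 10 ^ 6) ^ 2 * (lam ^ 4 * δ * ε ^ 2)) :
    G * (T * β * σ ^ 2) ≤ 1600 / 10 ^ 12 * (lam * (T * δ * ε ^ 2)) ∧
    B ≤ 8 * (T * β * σ ^ 2) + lam / (50 * G) * S ∧
    S ≤ 10 * (G * Δ / η) + 60 * (G * (T * β * σ ^ 2) / lam) := by
  have e1 : G * (T * β * σ ^ 2) ≤ 1600 / 10 ^ 12 * (lam * (T * δ * ε ^ 2)) := by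
    have hl3 : 0 < lam ^ 3 := by positivity
    refine le_of_mul_le_mul_right (a := lam ^ 3) ?_ hl3
    calc G * (T * β * σ ^ 2) * lam ^ 3 = T * σ ^ 2 * G * (β * lam ^ 3) := by ring
      _ = 1600 * T * (η * (σ * G * L)) ^ 2 := by rw [hβ]; ring
      _ ≤ 1600 * T * ((1 / 10 ^ 6) ^ 2 * (lam ^ 4 * δ * ε ^ 2)) := by gcongr
      _ = _ := by ring
  have e2 : B ≤ 8 * (T * β * σ ^ 2) + lam / (50 * G) * S := by
    refine le_of_mul_le_mul_left (a := β / 2) ?_ (by positivity)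
    calc β / 2 * B ≤ 4 * T * β ^ 2 * σ ^ 2 + β * lam / (100 * G) * S := by linarith
      _ = _ := by field_simp; ring
  refine ⟨e1, e2, ?_⟩
  have e3 : S ≤ 8 * (G * Δ / η) + 6 * (G * B / lam) := by
    refine le_of_mul_le_mul_left (a := η / (8 * G)) ?_ (by positivity)
    calc η / (8 * G) * S ≤ Δ + 3 * η / (4 * lam) * B := h2
      _ = _ := by field_simp; ring
  -- Inserting the variance bound into the descent bound returns `S` with coefficient `6 / 50`,
  -- which is absorbed on the left.
  have e4 : G * B / lam ≤ 8 * (G * (T * β * σ ^ 2) / lam) + 1 / 50 * S := by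
    calc G * B / lam ≤ G * (8 * (T * β * σ ^ 2) + lam / (50 * G) * S) / lam := by gcongr
      _ = _ := by field_simp
  have hE : 0 ≤ G * (T * β * σ ^ 2) / lam := by positivity
  have hK : 0 ≤ G * Δ / η := by positivity
  linarith

/-- The expected sum of squared gradients in terms of the accuracy. -/
theorem expected_gradSq_le {δ ε G lam η Δ β σ T S : ℝ} (hlam : 0 < lam)
    (h3 : G * (T * β * σ ^ 2) ≤ 1600 / 10 ^ 12 * (lam * (T * δ * ε ^ 2)))
    (h4 : S ≤ 10 * (G * Δ / η) + 60 * (G * (T * β * σ ^ 2) / lam)) (h0 : 0 ≤ T * δ * ε ^ 2)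
    (hT : 10 ^ 5 * (G * Δ / η) ≤ T * δ * ε ^ 2) : S ≤ δ / 8 * (ε ^ 2 * T) := by
  have : G * (T * β * σ ^ 2) / lam ≤ 1600 / 10 ^ 12 * (T * δ * ε ^ 2) := by
    rw [div_le_iff₀ hlam]
    linarith
  linarith

/-- The bounds on the expected momentum error at the exit time, and on the expected sum of
squares, which make an early exit unlikely. -/
theorem expected_exit_le {δ ε G lam η L Δ β σ T Y B S : ℝ} (hG : 0 < G) (hlam : 0 < lam)
    (hη : 0 < η) (hL : 0 < L) (hΔ : 0 < Δ) (hδ : 0 < δ) (hβ0 : 0 < β) (hB : 0 ≤ B)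
    (hlG : 2 * lam ≤ G)
    (h1 : Y + β / 2 * B ≤ 4 * T * β ^ 2 * σ ^ 2 + β * lam / (100 * G) * S)
    (hβ : β * lam ^ 3 = 1600 * L ^ 2 * G * η ^ 2)
    (h3 : G * (T * β * σ ^ 2) ≤ 1600 / 10 ^ 12 * (lam * (T * δ * ε ^ 2)))
    (h4 : B ≤ 8 * (T * β * σ ^ 2) + lam / (50 * G) * S)
    (h5 : S ≤ 10 * (G * Δ / η) + 60 * (G * (T * β * σ ^ 2) / lam))
    (hT : T * δ * ε ^ 2 ≤ 2 * 10 ^ 5 * (G * Δ / η))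
    (hηΔ : η * (Δ * L ^ 2) ≤ 1 / 10 ^ 6 * (lam ^ 2 * G * δ))
    (hLΔ : 10 ^ 5 * (L * Δ) ≤ 7 * (G * δ * lam)) :
    Y ≤ δ / 8 * G ^ 2 ∧ S + B ≤ δ / 8 * (lam * G ^ 2 / (12 * L * η)) := by
  set K := G * Δ / η with hK
  have hK0 : 0 < K := by positivity
  set E := T * β * σ ^ 2 with hE
  -- The upper bound on `T` makes the accumulated noise a tiny fraction of `K`.
  have e1 : G * E / lam ≤ 4 / 10 ^ 4 * K := by
    rw [div_le_iff₀ hlam]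
    nlinarith
  have e1' : E ≤ 4 / 10 ^ 4 * (lam / G * K) := by
    calc E = lam / G * (G * E / lam) := by field_simp
      _ ≤ lam / G * (4 / 10 ^ 4 * K) := by gcongr
      _ = _ := by ring
  have hlG' : lam / G ≤ 1 / 2 := by rw [div_le_iff₀ hG]; linarith
  have e2 : S ≤ 11 * K := by linarith
  have e3 : lam / G * S ≤ 11 * (lam / G * K) := by
    calc lam / G * S ≤ lam / G * (11 * K) := by gcongr
      _ = _ := by ring
  have e4 : lam / G * K ≤ 1 / 2 * K := by gcongr
  have e5 : lam / (50 * G) * S = 1 / 50 * (lam / G * S) := by field_simp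
  constructor
  · have f1 : 4 * T * β ^ 2 * σ ^ 2 + β * lam / (100 * G) * S
        = β * (4 * E + 1 / 100 * (lam / G * S)) := by
      rw [hE]; field_simp
    have f2 : β * (4 * E + 1 / 100 * (lam / G * S)) ≤ β * (1 / 5 * (lam / G * K)) := by
      gcongr
      have : 0 ≤ lam / G * K := by positivity
      linarith
    -- Substituting `β` turns this into the condition of `η` against `λ² G δ / (Δ L²)`.
    have f3 : β * (1 / 5 * (lam / G * K)) ≤ δ / 8 * G ^ 2 := by
      have : β * (1 / 5 * (lam / G * K)) = 320 * G * (η * (Δ * L ^ 2)) / lam ^ 2 := by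
        rw [hK]; field_simp; linear_combination hβ
      rw [this, div_le_iff₀ (by positivity)]
      calc 320 * G * (η * (Δ * L ^ 2)) ≤ 320 * G * (1 / 10 ^ 6 * (lam ^ 2 * G * δ)) := by gcongr
        _ = 320 / 10 ^ 6 * (δ * G ^ 2 * lam ^ 2) := by ring
        _ ≤ 1 / 8 * (δ * G ^ 2 * lam ^ 2) :=
          mul_le_mul_of_nonneg_right (by norm_num) (by positivity)
        _ = _ := by ring
    have f4 : 0 ≤ β / 2 * B := by positivity
    linarith
  · have f1 : S + B ≤ 12 * K := by linarith
    refine f1.trans ?_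
    rw [hK]
    -- What remains is `1152 L Δ ≤ G δ λ`, which follows from `hLΔ`, the form in which the lower
    -- bound on `G` enters.
    have : δ / 8 * (lam * G ^ 2 / (12 * L * η)) = (G / η) * (G * δ * lam / (96 * L)) := by
      field_simp; norm_num
    rw [this]
    calc 12 * (G * Δ / η) = (G / η) * (12 * Δ) := by ring
      _ ≤ (G / η) * (G * δ * lam / (96 * L)) := by
        gcongr
        rw [le_div_iff₀ (by positivity)]
        nlinarith

/-- The conditions under which VRAdam is analysed: those on single steps, and those that relate
the step size to the failure probability and the accuracy. -/
structure RunRegime (δ ε ρ σ L₀ Lρ lam G η β Δ : ℝ) (N S₁ : ℕ) : Prop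
    extends StepRegime ρ σ L₀ Lρ lam G η β where
  delta_pos : 0 < δ
  eps_pos : 0 < ε
  effL_pos : 0 < effL ρ L₀ Lρ G
  gap_pos : 0 < Δ
  beta_pos : 0 < β
  batch_ne_zero : S₁ ≠ 0
  eta_sigma_le : (η * (σ * G * effL ρ L₀ Lρ G)) ^ 2 ≤ (1 / 10 ^ 6) ^ 2 * (lam ^ 4 * δ * ε ^ 2)
  eta_gap_le : η * (Δ * effL ρ L₀ Lρ G ^ 2) ≤ 1 / 10 ^ 6 * (lam ^ 2 * G * δ)
  gap_le : 10 ^ 5 * (effL ρ L₀ Lρ G * Δ) ≤ 7 * (G * δ * lam)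
  le_T : 10 ^ 5 * (G * Δ / η) ≤ ((N : ℝ) + 1) * δ * ε ^ 2
  T_le : N ≠ 0 → ((N : ℝ) + 1) * δ * ε ^ 2 ≤ 2 * 10 ^ 5 * (G * Δ / η)
  batch_le : 1 / (S₁ : ℝ) ≤ 2 * β ^ 2 * (N + 1)

section

variable {d : ℕ} {D : Set (Vec d)} {f : Vec d → ℝ} {δ ε ρ σ L₀ Lρ lam G η β βsq : ℝ}
  {Ξ : Type*} [MeasurableSpace Ξ] {P : Measure Ξ} {F : Vec d → Ξ → ℝ} {x₁ : Vec d} {S₁ N : ℕ}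
  {ι : Type*} {e : Fin S₁ → ι} {τ : ℕ → ι} [Fintype ι] [IsProbabilityMeasure P] [DecidableEq ι]

theorem integrable_active_errSq_self (hp : Problem D f P F ρ σ L₀ Lρ)
    (hr : StepRegime ρ σ L₀ Lρ lam G η β) (hx₁ : x₁ ∈ D) (hS : S₁ ≠ 0)
    (hc : DistinctCoordinates e τ (N + 1)) {k : ℕ} (hk : k ≤ N) :
    Integrable (fun u : ι → Ξ => active D f G η lam (run D F η β βsq lam x₁ e τ u) k
      * errSq D f (run D F η β βsq lam x₁ e τ u k)) (Measure.pi fun _ => P) := by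
  cases k with
  | zero => exact (integral_errSq_zero_le hp hx₁ hS hc).1
  | succ k => exact (integral_errSq_succ_le hp hr hc hk).1

/-- Outside a set of small probability, the good part of the run does not end by a large momentum
error, its sum of squares is small, and its average squared gradient is at most `ε²`. -/
theorem exists_exceptional_set (hp : Problem D f P F ρ σ L₀ Lρ)
    (hr : RunRegime δ ε ρ σ L₀ Lρ lam G η β (initGap D f x₁) N S₁) (hx₁ : x₁ ∈ D)
    (hc : DistinctCoordinates e τ (N + 1)) :
    ∃ E : Set (ι → Ξ), MeasurableSet E ∧ (Measure.pi fun _ : ι => P).real E ≤ δ ∧ ∀ u ∉ E,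
      (N ≠ 0 → ∀ k ≤ N, (∀ j < k, Good D f G η lam (run D F η β βsq lam x₁ e τ u j)) →
        errSq D f (run D F η β βsq lam x₁ e τ u k) ≤ G ^ 2) ∧
      (N ≠ 0 → ∑ k ∈ Finset.range (N + 1), active D f G η lam (run D F η β βsq lam x₁ e τ u) (k + 1)
        * (gradSq D f (run D F η β βsq lam x₁ e τ u k)
          + errSq D f (run D F η β βsq lam x₁ e τ u k))
        ≤ lam * G ^ 2 / (12 * effL ρ L₀ Lρ G * η)) ∧
      ∑ k ∈ Finset.range (N + 1), active D f G η lam (run D F η β βsq lam x₁ e τ u) (k + 1)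
        * gradSq D f (run D F η β βsq lam x₁ e τ u k) ≤ ε ^ 2 * (N + 1) := by
  have hG := hr.G_pos
  have hl := hr.lam_pos
  have hη := hr.eta_pos
  have hL := hr.effL_pos
  have hδ := hr.delta_pos
  have hε := hr.eps_pos
  have hβ := hr.beta_pos
  have hsr := hr.toStepRegime
  have hbi := fun k => integrable_active_errSq (G := G) (η := η) (β := β) (βsq := βsq) (lam := lam)
    (x₁ := x₁) (e := e) (τ := τ) hp k
  have hgi := fun k => integrable_active_gradSq (G := G) (η := η) (β := β) (βsq := βsq) (lam := lam)
    (x₁ := x₁) (e := e) (τ := τ) hp k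
  have hai := fun k hk => integrable_active_errSq_self (βsq := βsq) hp hsr hx₁ hr.batch_ne_zero hc
    (k := k) hk
  have ha0 := (integral_errSq_zero_le (G := G) (η := η) (β := β) (βsq := βsq) (lam := lam)
    hp hx₁ hr.batch_ne_zero hc).2
  have hrec := fun k hk => (integral_errSq_succ_le (βsq := βsq) (x₁ := x₁) hp hsr hc (k := k) hk).2
  have hpath := fun u : ι → Ξ => sum_active_gradSq_le hp hsr (s := run D F η β βsq lam x₁ e τ u)
    (fun k => rfl) hx₁ (N + 1)
  set μ := Measure.pi fun _ : ι => P with hμ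
  set X : (ι → Ξ) → ℕ → State d := fun u => run D F η β βsq lam x₁ e τ u with hX
  set act : (ι → Ξ) → ℕ → ℝ := fun u k => active D f G η lam (X u) k with hact
  have hbm : ∀ k, Measurable fun u => act u (k + 1) * errSq D f (X u k) := fun k =>
    (measurable_active_run hp (k + 1)).mul (measurable_errSq_run hp k)
  have ham : ∀ k, Measurable fun u => act u k * errSq D f (X u k) := fun k =>
    (measurable_active_run hp k).mul (measurable_errSq_run hp k)
  have hgm : ∀ k, Measurable fun u => act u (k + 1) * gradSq D f (X u k) := fun k =>
    (measurable_active_run hp (k + 1)).mul (measurable_gradSq_run hp k)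
  have hb0 : ∀ u k, 0 ≤ act u (k + 1) * errSq D f (X u k) := fun u k =>
    mul_nonneg (active_nonneg _) (errSq_nonneg _)
  have hg0 : ∀ u k, 0 ≤ act u (k + 1) * gradSq D f (X u k) := fun u k =>
    mul_nonneg (active_nonneg _) (gradSq_nonneg _)
  have hab : ∀ u k, 0 ≤ act u k * errSq D f (X u k) - act u (k + 1) * errSq D f (X u k) := by
    intro u k
    rw [← sub_mul]
    exact mul_nonneg (sub_nonneg.2 (active_succ_le k)) (errSq_nonneg _)
  -- The two indicators differ only at the first bad state, so `Yf` is the squared error there, or 0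
  -- if there is none.
  set Yf : (ι → Ξ) → ℝ := fun u => ∑ k ∈ Finset.range (N + 1),
    (act u k * errSq D f (X u k) - act u (k + 1) * errSq D f (X u k)) with hYf
  set Bf : (ι → Ξ) → ℝ := fun u => ∑ k ∈ Finset.range (N + 1), act u (k + 1) * errSq D f (X u k)
    with hBf
  set Sf : (ι → Ξ) → ℝ := fun u => ∑ k ∈ Finset.range (N + 1), act u (k + 1) * gradSq D f (X u k)
    with hSf
  have hle : ∀ k ∈ Finset.range (N + 1), k ≤ N := fun k hk => by
    rw [Finset.mem_range] at hk; omega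
  have hYi : Integrable Yf μ := integrable_finsetSum _ fun k hk => (hai k (hle k hk)).sub (hbi k)
  have hBi : Integrable Bf μ := integrable_finsetSum _ fun k _ => hbi k
  have hSi : Integrable Sf μ := integrable_finsetSum _ fun k _ => hgi k
  have hY0 : ∀ u, 0 ≤ Yf u := fun u => Finset.sum_nonneg fun k _ => hab u k
  have hB0 : ∀ u, 0 ≤ Bf u := fun u => Finset.sum_nonneg fun k _ => hb0 u k
  have hS0 : ∀ u, 0 ≤ Sf u := fun u => Finset.sum_nonneg fun k _ => hg0 u k
  have hYm : Measurable Yf := Finset.measurable_sum _ fun k _ => (ham k).sub (hbm k)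
  have hBm : Measurable Bf := Finset.measurable_sum _ fun k _ => hbm k
  have hSm : Measurable Sf := Finset.measurable_sum _ fun k _ => hgm k
  have hY : ∫ u, Yf u ∂μ = ∑ k ∈ Finset.range (N + 1),
      (∫ u, act u k * errSq D f (X u k) ∂μ - ∫ u, act u (k + 1) * errSq D f (X u k) ∂μ) := by
    refine (integral_finsetSum _ fun k hk => (hai k (hle k hk)).sub (hbi k)).trans ?_
    exact Finset.sum_congr rfl fun k hk => integral_sub (hai k (hle k hk)) (hbi k)
  have hB : ∫ u, Bf u ∂μ = ∑ k ∈ Finset.range (N + 1), ∫ u, act u (k + 1) * errSq D f (X u k) ∂μ :=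
    integral_finsetSum _ fun k _ => hbi k
  have hS : ∫ u, Sf u ∂μ = ∑ k ∈ Finset.range (N + 1), ∫ u, act u (k + 1) * gradSq D f (X u k) ∂μ :=
    integral_finsetSum _ fun k _ => hgi k
  have h1 : ∫ u, Yf u ∂μ + β / 2 * ∫ u, Bf u ∂μ
      ≤ 4 * ((N : ℝ) + 1) * β ^ 2 * σ ^ 2 + β * lam / (100 * G) * ∫ u, Sf u ∂μ := by
    have := sum_variance_recursion (N := N) (a := fun k => ∫ u, act u k * errSq D f (X u k) ∂μ)
      (b := fun k => ∫ u, act u (k + 1) * errSq D f (X u k) ∂μ)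
      (c := fun k => ∫ u, act u (k + 1) * gradSq D f (X u k) ∂μ) hsr.beta_le
      (show 0 ≤ β * lam / (100 * G) by positivity)
      (fun k => integral_nonneg fun u => hb0 u k) (fun k => integral_nonneg fun u => hg0 u k) hrec
    rw [hY, hB, hS]
    -- The batch is large enough for the initial variance not to exceed the noise `2 β² σ²` summed
    -- over all `N + 1` times; this doubles 2 to 4.
    have h3 : σ ^ 2 / S₁ ≤ 2 * β ^ 2 * (N + 1) * σ ^ 2 := by
      calc σ ^ 2 / S₁ = 1 / (S₁ : ℝ) * σ ^ 2 := by ring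
        _ ≤ _ := by gcongr; exact hr.batch_le
    have h4 : (0 : ℝ) ≤ 2 * β ^ 2 * σ ^ 2 := by positivity
    linarith
  have h2 : η / (8 * G) * ∫ u, Sf u ∂μ ≤ initGap D f x₁ + 3 * η / (4 * lam) * ∫ u, Bf u ∂μ := by
    rw [← integral_const_mul, ← integral_const_mul]
    have h3 : ∫ u, (initGap D f x₁ + 3 * η / (4 * lam) * Bf u) ∂μ
        = initGap D f x₁ + ∫ u, 3 * η / (4 * lam) * Bf u ∂μ := by
      rw [integral_add (integrable_const _) (hBi.const_mul _)]
      simp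
    rw [← h3]
    exact integral_mono (hSi.const_mul _) ((integrable_const _).add (hBi.const_mul _)) hpath
  obtain ⟨e1, e2, e3⟩ := expected_gradSq_bound hG hl hη hr.gap_pos hβ (integral_nonneg hY0) h1 h2 hsr.beta_eq
    (by positivity) hr.eta_sigma_le
  have hSle := expected_gradSq_le hl e1 e3 (by positivity) hr.le_T
  have hSprob : μ.real {u | ε ^ 2 * ((N : ℝ) + 1) ≤ Sf u} ≤ δ / 8 := by
    refine (measureReal_ge_le_integral_div hS0 hSi (by positivity)).trans ?_
    rw [div_le_iff₀ (by positivity)]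
    exact hSle
  have hSset : MeasurableSet {u | ε ^ 2 * ((N : ℝ) + 1) ≤ Sf u} :=
    measurableSet_le measurable_const hSm
  -- For a single iterate the ceiling may make `T` much larger than its argument, so `T_le` is not
  -- available; no exit estimate is needed there.
  rcases eq_or_ne N 0 with hN | hN
  · refine ⟨{u | ε ^ 2 * ((N : ℝ) + 1) ≤ Sf u}, hSset, by linarith, fun u hu => ?_⟩
    exact ⟨fun h => absurd hN h, fun h => absurd hN h, (not_le.1 hu).le⟩
  obtain ⟨e4, e5⟩ := expected_exit_le hG hl hη hL hr.gap_pos hδ hβ (integral_nonneg hB0) hsr.lam_le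
    h1 hsr.beta_eq e1 e2 e3 (hr.T_le hN) hr.eta_gap_le hr.gap_le
  set θ := lam * G ^ 2 / (12 * effL ρ L₀ Lρ G * η) with hθ
  have hθ0 : 0 < θ := by positivity
  have hYprob : μ.real {u | G ^ 2 ≤ Yf u} ≤ δ / 8 := by
    refine (measureReal_ge_le_integral_div hY0 hYi (by positivity)).trans ?_
    rw [div_le_iff₀ (by positivity)]
    exact e4
  have hQprob : μ.real {u | θ ≤ Sf u + Bf u} ≤ δ / 8 := by
    refine (measureReal_ge_le_integral_div (fun u => add_nonneg (hS0 u) (hB0 u))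
      (hSi.add hBi) hθ0).trans ?_
    rw [div_le_iff₀ hθ0, integral_add hSi hBi]
    exact e5
  refine ⟨{u | ε ^ 2 * ((N : ℝ) + 1) ≤ Sf u} ∪ ({u | G ^ 2 ≤ Yf u} ∪ {u | θ ≤ Sf u + Bf u}),
    hSset.union ((measurableSet_le measurable_const hYm).union
      (measurableSet_le measurable_const (hSm.add hBm))), ?_, fun u hu => ?_⟩
  · have h3 := measureReal_union_le (μ := μ) {u | ε ^ 2 * ((N : ℝ) + 1) ≤ Sf u}
      ({u | G ^ 2 ≤ Yf u} ∪ {u | θ ≤ Sf u + Bf u})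
    have h4 := measureReal_union_le (μ := μ) {u | G ^ 2 ≤ Yf u} {u | θ ≤ Sf u + Bf u}
    linarith
  · simp only [Set.mem_union, Set.mem_ofPred_eq, not_or, not_le] at hu
    obtain ⟨hu1, hu2, hu3⟩ := hu
    refine ⟨fun _ k hk hgood => ?_, fun _ => ?_, hu1.le⟩
    · by_contra! hlt
      -- An error above `G` makes state `k` itself bad, so the full squared error appears in `Yf`.
      have hnot : ¬ ∀ j < k + 1, Good D f G η lam (X u j) := by
        intro h
        have := pow_le_pow_left₀ (norm_nonneg _) (h k (by omega)).norm_err_le 2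
        exact absurd hlt (not_lt.2 this)
      have h3 : act u k * errSq D f (X u k) - act u (k + 1) * errSq D f (X u k) ≤ Yf u :=
        Finset.single_le_sum (f := fun k =>
          act u k * errSq D f (X u k) - act u (k + 1) * errSq D f (X u k))
          (fun k _ => hab u k) (Finset.mem_range.2 (by omega))
      have h4 : act u k = 1 := active_of_forall hgood
      have h5 : act u (k + 1) = 0 := active_of_not_forall hnot
      rw [h4, h5] at h3
      simp only [one_mul, zero_mul, sub_zero] at h3
      change G ^ 2 < errSq D f (X u k) at hlt
      linarith
    · simp only [mul_add, Finset.sum_add_distrib]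
      exact hu3.le

/-- Almost surely, the noise along the run is bounded by `σ`. -/
theorem ae_noise_le (hp : Problem D f P F ρ σ L₀ Lρ) (hx₁ : x₁ ∈ D)
    (hc : DistinctCoordinates e τ (N + 1)) :
    ∀ᵐ u ∂(Measure.pi fun _ : ι => P),
      (∀ j, ‖sgrad F x₁ (u (e j)) - gradient f x₁‖ ≤ σ) ∧
      ∀ k < N, (run D F η β βsq lam x₁ e τ u (k + 1)).x ∈ D →
        ‖sgradExt D F (run D F η β βsq lam x₁ e τ u (k + 1)).x (u (τ (k + 2)))
          - gradExt D f (run D F η β βsq lam x₁ e τ u (k + 1)).x‖ ≤ σ := by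
  rw [Filter.eventually_and]
  constructor
  · rw [ae_all_iff]
    intro j
    refine ae_pi_of_forall_ae_update (e j) ?_ fun u => ?_
    · exact measurableSet_le ((((hp.measurable_sgrad x₁ hx₁).comp
        (measurable_pi_apply (e j))).sub_const _).norm) measurable_const
    · filter_upwards [hp.noise x₁ hx₁] with z hz
      rwa [Function.update_self]
  · rw [ae_all_iff]
    intro k
    rw [ae_all_iff]
    intro hk
    have hx := (measurable_run (η := η) (β := β) (βsq := βsq) (lam := lam) (x₁ := x₁) (e := e)
      (τ := τ) hp (k + 1)).1
    refine ae_pi_of_forall_ae_update (τ (k + 2)) ?_ fun u => ?_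
    · have h1 : MeasurableSet {u : ι → Ξ | (run D F η β βsq lam x₁ e τ u (k + 1)).x ∈ D} :=
        hx hp.isOpen.measurableSet
      refine h1.imp (measurableSet_le (Measurable.norm (Measurable.sub ?_ ?_)) measurable_const)
      · exact hp.measurable_sgradExt.comp (hx.prodMk (measurable_pi_apply _))
      · exact hp.measurable_gradExt.comp hx
    -- The iterate does not depend on the sample drawn at it, so the almost sure bound at a fixed
    -- point applies coordinatewise.
    · have hxu : ∀ z, (run D F η β βsq lam x₁ e τ (Function.update u (τ (k + 2)) z) (k + 1)).x
          = (run D F η β βsq lam x₁ e τ u k).next := by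
        intro z
        rw [run_succ_update hc hk]; rfl
      simp only [hxu, Function.update_self]
      by_cases hD : (run D F η β βsq lam x₁ e τ u k).next ∈ D
      · filter_upwards [hp.noise _ hD] with z hz _
        rwa [sgradExt_of_mem hD, gradExt_of_mem hD]
      · exact Filter.Eventually.of_forall fun z h => absurd h hD

/-- With probability at least `1 - δ`, a run that stays in `D` has gradients bounded by `G` and
average squared gradient at most `ε²`. -/
theorem exists_exceptional_set_convergence (hp : Problem D f P F ρ σ L₀ Lρ)
    (hr : RunRegime δ ε ρ σ L₀ Lρ lam G η β (initGap D f x₁) N S₁) (hx₁ : x₁ ∈ D)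
    (hg₁ : 2 * ‖gradient f x₁‖ ≤ G) (hβ0 : 0 ≤ βsq) (hβ1 : βsq ≤ 1)
    (hc : DistinctCoordinates e τ (N + 1)) :
    ∃ E : Set (ι → Ξ), MeasurableSet E ∧ (Measure.pi fun _ : ι => P).real E ≤ δ ∧
      ∀ᵐ u ∂(Measure.pi fun _ : ι => P), u ∉ E →
        (∀ k ≤ N, segment ℝ (run D F η β βsq lam x₁ e τ u k).x
          (run D F η β βsq lam x₁ e τ u k).next ⊆ D) →
        (∀ k ≤ N, ‖gradient f (run D F η β βsq lam x₁ e τ u k).x‖ ≤ G) ∧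
        ∑ k ∈ Finset.range (N + 1), ‖gradient f (run D F η β βsq lam x₁ e τ u k).x‖ ^ 2
          ≤ ε ^ 2 * (N + 1) := by
  obtain ⟨E, hE, hEδ, hEu⟩ := exists_exceptional_set (βsq := βsq) hp hr hx₁ hc
  refine ⟨E, hE, hEδ, ?_⟩
  filter_upwards [ae_noise_le (η := η) (β := β) (βsq := βsq) (lam := lam) hp hx₁ hc]
    with u hnoise hu hseg
  obtain ⟨hE1, hE2, hE3⟩ := hEu u hu
  have hG := hr.G_pos
  have hmem : ∀ k ≤ N, (run D F η β βsq lam x₁ e τ u k).x ∈ D := fun k hk =>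
    hseg k hk (left_mem_segment ℝ _ _)
  have hgx₁ : gradExt D f x₁ = gradient f x₁ := gradExt_of_mem hx₁
  have herr0 : ‖(run D F η β βsq lam x₁ e τ u 0).m - gradExt D f x₁‖ ≤ σ := by
    rw [run_zero_m_sub hx₁ hr.batch_ne_zero, norm_smul, Real.norm_of_nonneg (by positivity)]
    have hS' : (S₁ : ℝ) ≠ 0 := Nat.cast_ne_zero.2 hr.batch_ne_zero
    calc (S₁ : ℝ)⁻¹ * ‖∑ j, (sgrad F x₁ (u (e j)) - gradient f x₁)‖
        ≤ (S₁ : ℝ)⁻¹ * ∑ j : Fin S₁, σ := by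
          gcongr
          exact norm_sum_le_of_le _ fun j _ => hnoise.1 j
      _ = σ := by simp [hS']
  -- The level `3 G / 2` also bounds the later stochastic gradients, of norm at most `G + σ`. With
  -- `λ ≤ G / 2` it yields the lower step size `η / (2 G)`.
  have hm0 : ‖(run D F η β βsq lam x₁ e τ u 0).m‖ ≤ 3 / 2 * G := by
    have := norm_add_le ((run D F η β βsq lam x₁ e τ u 0).m - gradExt D f x₁) (gradExt D f x₁)
    rw [sub_add_cancel, hgx₁] at this
    rw [hgx₁] at herr0
    linarith [hr.sigma_le]
  have hgood := forall_good hp hr.toStepRegime hr.effL_pos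
    (s := run D F η β βsq lam x₁ e τ u) (fun k => rfl) (by
      change 2 * ‖gradExt D f x₁‖ ≤ G
      rwa [hgx₁]) hseg
    (fun k hk hgr i => by
      obtain ⟨a, h1, h2, h3⟩ := oracleState_exists_step_size hr.eta_pos hr.lam_pos hβ0 hβ1 x₁
        (fun j => u (e j)) (fun t => u (τ t)) k hm0 (fun j hj => by
          have h1 := hnoise.2 j (by omega) (hmem (j + 1) (by omega))
          have h2 := hgr (j + 1) hj
          have h3 := norm_add_le (sgradExt D F (run D F η β βsq lam x₁ e τ u (j + 1)).x
            (u (τ (j + 2))) - gradExt D f (run D F η β βsq lam x₁ e τ u (j + 1)).x)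
            (gradExt D f (run D F η β βsq lam x₁ e τ u (j + 1)).x)
          rw [sub_add_cancel] at h3
          refine h3.trans ?_
          linarith [hr.sigma_le]) i
      refine ⟨a, le_trans ?_ h1, h2, h3⟩
      have := hr.eta_pos
      have := hr.lam_pos
      gcongr
      linarith [hr.lam_le])
    (fun k hk hgd => by
      -- If `T = 1`, the only error is the initial one, which is almost surely at most `σ ≤ G`.
      rcases eq_or_ne N 0 with hN | hN
      · obtain rfl : k = 0 := by omega
        refine pow_le_pow_left₀ (norm_nonneg _) (herr0.trans ?_) 2
        linarith [hr.sigma_le]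
      · exact hE1 hN k hk hgd)
    hE2
  have hgrad : ∀ k ≤ N, gradExt D f (run D F η β βsq lam x₁ e τ u k).x
      = gradient f (run D F η β βsq lam x₁ e τ u k).x := fun k hk => gradExt_of_mem (hmem k hk)
  refine ⟨fun k hk => ?_, ?_⟩
  · rw [← hgrad k hk]; exact (hgood k hk).norm_grad_le
  · refine le_trans (le_of_eq (Finset.sum_congr rfl fun k hk => ?_)) hE3
    rw [Finset.mem_range] at hk
    rw [active_of_forall fun j hj => hgood j (by omega), one_mul, gradSq, hgrad k (by omega)]

end

/-! ### From the parameter choice to the regime of the analysis -/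

theorem mul_le_mul_of_ofReal_le_mul_div {η c a b : ℝ} (hc : 0 ≤ c) (ha : 0 ≤ a) (hb : 0 ≤ b)
    (h : ENNReal.ofReal η ≤ ENNReal.ofReal c * (ENNReal.ofReal a / ENNReal.ofReal b)) :
    η * b ≤ c * a := by
  -- A vanishing denominator makes the product form trivial, whatever value the extended quotient
  -- takes.
  rcases hb.eq_or_lt with rfl | hb
  · simpa using mul_nonneg hc ha
  · rw [← ENNReal.ofReal_div_of_pos hb, ← ENNReal.ofReal_mul hc,
      ENNReal.ofReal_le_ofReal_iff (by positivity)] at h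
    calc η * b ≤ c * (a / b) * b := by gcongr
      _ = c * a := by field_simp

theorem beta_mul_pow {L G lam η : ℝ} (hG : 0 ≤ G) (hlam : 0 < lam) :
    (40 * L * √G * lam ^ (-(3 / 2) : ℝ)) ^ 2 * η ^ 2 * lam ^ 3 = 1600 * L ^ 2 * G * η ^ 2 := by
  have h1 : (lam ^ (-(3 / 2) : ℝ)) ^ 2 * lam ^ 3 = 1 := by
    rw [← Real.rpow_natCast, ← Real.rpow_natCast lam, ← Real.rpow_mul hlam.le,
      ← Real.rpow_add hlam]
    norm_num
  have h2 : √G ^ 2 = G := Real.sq_sqrt hG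
  calc _ = 1600 * L ^ 2 * √G ^ 2 * η ^ 2 * ((lam ^ (-(3 / 2) : ℝ)) ^ 2 * lam ^ 3) := by ring
    _ = _ := by rw [h1, h2, mul_one]

/-- The `ρ` condition, raised to the power `1 - ρ` and multiplied by `G ^ ρ`, becomes linear in `G`
like the `L₀` condition; `7 = 3 + 4` collects the coefficients of `effL`. -/
theorem LargeG.effL_mul_le {C δ ρ lam σ L₀ Lρ Δ g₁ G : ℝ}
    (h : LargeG C δ ρ lam σ L₀ Lρ Δ g₁ G) (hC : 0 ≤ C) (hδ : 0 < δ) (hρ1 : ρ < 1) (hlam : 0 < lam)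
    (hLρ : 0 ≤ Lρ) (hΔ : 0 ≤ Δ) : C * (effL ρ L₀ Lρ G * Δ) ≤ 7 * (G * δ * lam) := by
  have hG := h.pos
  have h1 : C * Δ * L₀ ≤ G * (δ * lam) := (div_le_iff₀ (by positivity)).1 h.zero_le
  have h2 : C * Δ * Lρ / (δ * lam) ≤ G ^ (1 - ρ) := by
    have h0 : 0 ≤ C * Δ * Lρ / (δ * lam) := by positivity
    have h1ρ : 0 < 1 - ρ := by linarith
    calc C * Δ * Lρ / (δ * lam) = ((C * Δ * Lρ / (δ * lam)) ^ (1 / (1 - ρ))) ^ (1 - ρ) := by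
          rw [← Real.rpow_mul h0, one_div_mul_cancel h1ρ.ne', Real.rpow_one]
      _ ≤ G ^ (1 - ρ) := Real.rpow_le_rpow (Real.rpow_nonneg h0 _) h.rho_le h1ρ.le
  have h3 : C * Δ * Lρ ≤ G ^ (1 - ρ) * (δ * lam) := (div_le_iff₀ (by positivity)).1 h2
  have h4 : G ^ (1 - ρ) * G ^ ρ = G := by
    rw [← Real.rpow_add hG]; simp
  have h5 : C * Δ * Lρ * G ^ ρ ≤ G * (δ * lam) := by
    calc C * Δ * Lρ * G ^ ρ ≤ G ^ (1 - ρ) * (δ * lam) * G ^ ρ := by gcongr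
      _ = G ^ (1 - ρ) * G ^ ρ * (δ * lam) := by ring
      _ = _ := by rw [h4]
  unfold effL
  linarith

/-- The choice of parameters puts the run into the regime of the analysis. -/
theorem Choice.runRegime {δ ρ lam σ L₀ Lρ Δ g₁ ε G η β : ℝ} {T S₁ : ℕ}
    (h : Choice (1 / 10 ^ 6) (10 ^ 5) δ ρ lam σ L₀ Lρ Δ ε G η β T S₁)
    (hG : LargeG (10 ^ 5) δ ρ lam σ L₀ Lρ Δ g₁ G) (hδ : 0 < δ) (hρ1 : ρ < 1)
    (hlam : 0 < lam) (hσ : 0 ≤ σ) (hL₀ : 0 ≤ L₀) (hLρ : 0 ≤ Lρ) (hε : 0 < ε) :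
    T = T - 1 + 1 ∧ RunRegime δ ε ρ σ L₀ Lρ lam G η β Δ (T - 1) S₁ := by
  have hGpos := hG.pos
  have hη := h.eta_pos
  have hL0 := effL_nonneg (ρ := ρ) hL₀ hLρ hGpos
  have hβeq : β * lam ^ 3 = 1600 * effL ρ L₀ Lρ G ^ 2 * G * η ^ 2 := by
    rw [h.beta_eq]; exact beta_mul_pow hGpos.le hlam
  -- A finite batch excludes the degenerate cases: `β = 0` or `T = 0` would require `S₁ ≥ ∞`.
  -- Positivity of `β` gives `L > 0`, and positivity of the ceiling `T` gives `Δ > 0`.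
  have hq : 0 < 2 * β ^ 2 * (T : ℝ) := by
    by_contra! hc
    have := h.batch_le
    rw [ENNReal.ofReal_of_nonpos hc, ENNReal.inv_zero] at this
    exact ENNReal.natCast_ne_top S₁ (top_le_iff.1 this)
  have hβ0 : 0 ≤ β := by rw [h.beta_eq]; positivity
  have hβ : 0 < β := lt_of_le_of_ne hβ0 fun h0 => by rw [← h0] at hq; simp at hq
  have hT0 : T ≠ 0 := fun h0 => by rw [h0] at hq; simp at hq
  have hL : 0 < effL ρ L₀ Lρ G := lt_of_le_of_ne hL0 fun h0 => by
    rw [← h0] at hβeq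
    have : 0 < β * lam ^ 3 := by positivity
    simp at hβeq
    rcases hβeq with h1 | h1 <;> linarith
  set q := 10 ^ 5 * (G * Δ / (η * δ * ε ^ 2)) with hqdef
  have hqpos : 0 < q := by
    rw [← Nat.ceil_pos, ← h.T_eq]; omega
  have hΔ : 0 < Δ := by
    by_contra! hc
    have : q ≤ 0 := by
      refine mul_nonpos_of_nonneg_of_nonpos (by positivity) ?_
      exact div_nonpos_of_nonpos_of_nonneg (mul_nonpos_of_nonneg_of_nonpos hGpos.le hc)
        (by positivity)
    linarith
  have hTT : T = T - 1 + 1 := by omega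
  have hTcast : ((T - 1 : ℕ) : ℝ) + 1 = T := by exact_mod_cast hTT.symm
  have hqT : q ≤ T := by rw [h.T_eq]; exact Nat.le_ceil q
  have hqmul : q * δ * ε ^ 2 = 10 ^ 5 * (G * Δ / η) := by
    rw [hqdef]; field_simp
  have hbinv : (2 * β ^ 2 * (T : ℝ))⁻¹ ≤ (S₁ : ℝ) := by
    have := h.batch_le
    rw [← ENNReal.ofReal_inv_of_pos hq, ← ENNReal.ofReal_natCast] at this
    exact (ENNReal.ofReal_le_ofReal_iff (Nat.cast_nonneg _)).1 this
  have hS : (0 : ℝ) < S₁ := lt_of_lt_of_le (inv_pos.2 hq) hbinv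
  have hstep := h.eta_le
  unfold stepBound at hstep
  simp only at hstep
  have hsub : ∀ {x y : ℝ≥0∞}, y ≤ x → ENNReal.ofReal η ≤ ENNReal.ofReal (1 / 10 ^ 6) * y →
      ENNReal.ofReal η ≤ ENNReal.ofReal (1 / 10 ^ 6) * x := fun hxy hy =>
    hy.trans (mul_le_mul_right hxy _)
  have hc0 : (0 : ℝ) ≤ 1 / 10 ^ 6 := by positivity
  have b2 : η * effL ρ L₀ Lρ G ≤ 1 / 10 ^ 6 * lam :=
    mul_le_mul_of_ofReal_le_mul_div hc0 hlam.le hL0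
      (hsub ((min_le_left _ _).trans (min_le_right _ _)) hstep)
  have b3 : η * (Δ * effL ρ L₀ Lρ G ^ 2) ≤ 1 / 10 ^ 6 * (lam ^ 2 * G * δ) :=
    mul_le_mul_of_ofReal_le_mul_div hc0 (by positivity) (by positivity)
      (hsub ((min_le_right _ _).trans (min_le_left _ _)) hstep)
  have b4 : η * (σ * G * effL ρ L₀ Lρ G) ≤ 1 / 10 ^ 6 * (lam ^ 2 * √δ * ε) :=
    mul_le_mul_of_ofReal_le_mul_div hc0 (by positivity) (by positivity)
      (hsub ((min_le_right _ _).trans (min_le_right _ _)) hstep)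
  have bR := hsub ((min_le_left _ _).trans (min_le_left _ _)) hstep
  unfold effR at bR
  have b1 : η * (5 * Lρ * G ^ (ρ - 1)) ≤ 1 / 10 ^ 6 * (lam / G) := by
    refine mul_le_mul_of_ofReal_le_mul_div hc0 (by positivity) (by positivity) (hsub ?_ bR)
    rw [div_eq_mul_inv, mul_comm]
    exact mul_le_mul_right (min_le_left _ _) _
  refine ⟨hTT, ⟨⟨hGpos, hlam, hη, hG.lam_le, hG.sigma_le, ?_, ?_, ?_, hβeq, h.beta_le⟩, hδ, hε, hL,
    hΔ, hβ, ?_, ?_, b3, ?_, ?_, ?_, ?_⟩⟩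
  · rw [Real.rpow_sub_one hGpos.ne'] at b1
    have e1 : η * (5 * Lρ * (G ^ ρ / G)) * G = 5 * (η * (Lρ * G ^ ρ)) := by field_simp
    have e2 : 1 / 10 ^ 6 * (lam / G) * G = 1 / 10 ^ 6 * lam := by field_simp
    have e3 := mul_le_mul_of_nonneg_right b1 hGpos.le
    rw [e1, e2] at e3
    linarith
  · intro hρ0 hL₀0
    have b1' : η * (5 * (L₀ ^ (ρ - 1) * Lρ) ^ (1 / ρ)) ≤ 1 / 10 ^ 6 * (lam / G) := by
      refine mul_le_mul_of_ofReal_le_mul_div hc0 (by positivity) (by positivity) (hsub ?_ bR)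
      rw [div_eq_mul_inv, mul_comm, if_neg (not_or.2 ⟨hρ0, hL₀0⟩)]
      exact mul_le_mul_right (min_le_right _ _) _
    have e1 : η * (5 * (L₀ ^ (ρ - 1) * Lρ) ^ (1 / ρ)) * G
        = 5 * (η * G * (L₀ ^ (ρ - 1) * Lρ) ^ (1 / ρ)) := by ring
    have e2 : 1 / 10 ^ 6 * (lam / G) * G = 1 / 10 ^ 6 * lam := by field_simp
    have e3 := mul_le_mul_of_nonneg_right b1' hGpos.le
    rw [e1, e2] at e3
    linarith
  · linarith
  · rintro rfl
    simp at hS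
  · have := pow_le_pow_left₀ (by positivity) b4 2
    refine this.trans (le_of_eq ?_)
    rw [mul_pow, mul_pow, mul_pow, Real.sq_sqrt hδ.le]
    ring
  · exact hG.effL_mul_le (by positivity) hδ hρ1 hlam hLρ hΔ.le
  · rw [hTcast, ← hqmul]
    gcongr
  -- For `T ≥ 2` the argument `q` of the ceiling exceeds 1, so rounding up at most doubles it.
  · intro hN
    have h1 : 1 < q := by
      have : 1 < ⌈q⌉₊ := by rw [← h.T_eq]; omega
      exact_mod_cast Nat.lt_ceil.1 this
    have h2 : (T : ℝ) < q + 1 := by rw [h.T_eq]; exact Nat.ceil_lt_add_one hqpos.le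
    rw [hTcast, mul_assoc 2, ← hqmul]
    calc (T : ℝ) * δ * ε ^ 2 ≤ (2 * q) * δ * ε ^ 2 := by gcongr; linarith
      _ = _ := by ring
  · rw [hTcast, one_div]
    exact inv_le_of_inv_le₀ hq hbinv

/-! ### Transfer from the product space to the given probability space -/

section Transfer

variable {d : ℕ} {D : Set (Vec d)} {f : Vec d → ℝ} {Ξ : Type*} [MeasurableSpace Ξ] {P : Measure Ξ}
  {F : Vec d → Ξ → ℝ} {Ω : Type*} [MeasurableSpace Ω] {μ : Measure Ω} [IsProbabilityMeasure μ]
  {δ ρ lam σ L₀ Lρ ε G η β βsq : ℝ} {N S₁ : ℕ} {x₁ : Vec d}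
  {batch : Fin S₁ → Ω → Ξ} {ξ : ℕ → Ω → Ξ}

/-- Convergence of VRAdam with high probability, in the regime of the analysis. -/
theorem convergence (hp : Problem D f P F ρ σ L₀ Lρ)
    (hr : RunRegime δ ε ρ σ L₀ Lρ lam G η β (initGap D f x₁) N S₁) (hx₁ : x₁ ∈ D)
    (hg₁ : 2 * ‖gradient f x₁‖ ≤ G) (hβ0 : 0 ≤ βsq) (hβ1 : βsq ≤ 1)
    (hbatch : ∀ j, HasLaw (batch j) P μ) (hξ : ∀ t ∈ Finset.Icc 2 (N + 1), HasLaw (ξ t) P μ)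
    (hind : iIndepFun (Sum.elim batch (fun t : Finset.Icc 2 (N + 1) => ξ t)) μ)
    (hseg : ∀ t ∈ Finset.Icc 1 (N + 1), ∀ᵐ ω ∂μ,
      segment ℝ (iter F η β βsq lam x₁ (fun j => batch j ω) (fun s => ξ s ω) t)
        (iter F η β βsq lam x₁ (fun j => batch j ω) (fun s => ξ s ω) (t + 1)) ⊆ D) :
    1 - δ ≤ μ.real {ω |
      (∀ t ∈ Finset.Icc 1 (N + 1), ‖gradient f
        (iter F η β βsq lam x₁ (fun j => batch j ω) (fun s => ξ s ω) t)‖ ≤ G) ∧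
      (1 / ((N + 1 : ℕ) : ℝ)) * ∑ t ∈ Finset.Icc 1 (N + 1), ‖gradient f
        (iter F η β βsq lam x₁ (fun j => batch j ω) (fun s => ξ s ω) t)‖ ^ 2 ≤ ε ^ 2} := by
  classical
  set j₀ : Fin S₁ := ⟨0, Nat.pos_of_ne_zero hr.batch_ne_zero⟩
  have hP : IsProbabilityMeasure P := by
    rw [← (hbatch j₀).map_eq]
    exact Measure.isProbabilityMeasure_map (hbatch j₀).aemeasurable
  set X : (Fin S₁ ⊕ Finset.Icc 2 (N + 1)) → Ω → Ξ :=
    Sum.elim batch (fun t : Finset.Icc 2 (N + 1) => ξ t) with hX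
  have hlaw : ∀ i, HasLaw (X i) P μ := by
    rintro (j | t)
    · exact hbatch j
    · exact hξ t t.2
  set Φ : Ω → (Fin S₁ ⊕ Finset.Icc 2 (N + 1)) → Ξ := fun ω i => X i ω with hΦ
  have hΦm : AEMeasurable Φ μ := aemeasurable_pi_lambda _ fun i => (hlaw i).aemeasurable
  -- Independence and identical laws say that the samples jointly have the product law, so almost
  -- sure statements on the product space pull back.
  have hmap : Measure.map Φ μ = Measure.pi fun _ => P := by
    rw [(iIndepFun_iff_map_fun_eq_pi_map fun i => (hlaw i).aemeasurable).1 hind]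
    congr 1
    funext i
    exact (hlaw i).map_eq
  set e : Fin S₁ → (Fin S₁ ⊕ Finset.Icc 2 (N + 1)) := Sum.inl with he
  set τ : ℕ → (Fin S₁ ⊕ Finset.Icc 2 (N + 1)) := fun t =>
    if h : t ∈ Finset.Icc 2 (N + 1) then Sum.inr ⟨t, h⟩ else Sum.inl j₀ with hτ
  have hτt : ∀ t, 2 ≤ t → ∀ ht : t ≤ N + 1,
      ∃ h : t ∈ Finset.Icc 2 (N + 1), τ t = Sum.inr ⟨t, h⟩ := fun t h2 ht =>
    ⟨Finset.mem_Icc.2 ⟨h2, ht⟩, dif_pos _⟩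
  have hc : DistinctCoordinates e τ (N + 1) := by
    refine ⟨Sum.inl_injective, fun j t h2 ht => ?_, fun t t' h2 htt ht => ?_⟩
    · obtain ⟨_, h⟩ := hτt t h2 ht
      rw [h]; exact Sum.inl_ne_inr
    · obtain ⟨_, h⟩ := hτt t h2 (by omega)
      obtain ⟨_, h'⟩ := hτt t' (by omega) ht
      rw [h, h']
      intro heq
      simp only [Sum.inr.injEq, Subtype.mk.injEq] at heq
      omega
  obtain ⟨E, hE, hEδ, hEae⟩ := exists_exceptional_set_convergence (βsq := βsq) hp hr hx₁ hg₁ hβ0 hβ1 hc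
  have hEae' := ae_of_ae_map hΦm (hmap ▸ hEae)
  have hprob : 1 - δ ≤ μ.real (Φ ⁻¹' Eᶜ) := by
    have h1 : μ.real (Φ ⁻¹' Eᶜ) = (Measure.pi fun _ : Fin S₁ ⊕ Finset.Icc 2 (N + 1) => P).real Eᶜ := by
      rw [← hmap, measureReal_def, measureReal_def,
        Measure.map_apply_of_aemeasurable hΦm hE.compl]
    rw [h1, probReal_compl_eq_one_sub hE]
    linarith
  refine hprob.trans ?_
  rw [measureReal_def, measureReal_def]
  -- The target event is not shown to be measurable; an almost sure inclusion suffices for the outer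
  -- measure.
  refine ENNReal.toReal_mono (measure_ne_top _ _) (measure_mono_ae ?_)
  have hsegall : ∀ᵐ ω ∂μ, ∀ t ∈ Finset.Icc 1 (N + 1),
      segment ℝ (iter F η β βsq lam x₁ (fun j => batch j ω) (fun s => ξ s ω) t)
        (iter F η β βsq lam x₁ (fun j => batch j ω) (fun s => ξ s ω) (t + 1)) ⊆ D :=
    (Finset.eventually_all _).2 hseg
  filter_upwards [hEae', hsegall] with ω hω hsω hωE
  have hωE' : Φ ω ∉ E := hωE
  have hiter : ∀ k, iter F η β βsq lam x₁ (fun j => batch j ω) (fun s => ξ s ω) (k + 1)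
      = (state F η β βsq lam x₁ (fun j => batch j ω) (fun s => ξ s ω) k).x := fun k => rfl
  have hstate : ∀ k ≤ N, state F η β βsq lam x₁ (fun j => batch j ω) (fun s => ξ s ω) k
      = oracleState (sgrad F) η β βsq lam x₁ (fun j => Φ ω (e j)) (fun t => Φ ω (τ t)) k := by
    intro k hk
    rw [state_eq_oracleState]
    refine oracleState_congr_samples x₁ (fun j => rfl) k fun t h2 ht => ?_
    obtain ⟨_, h⟩ := hτt t h2 (by omega)
    rw [h]
    rfl
  have hsegk : ∀ k ≤ N, segment ℝ
      (state F η β βsq lam x₁ (fun j => batch j ω) (fun s => ξ s ω) k).x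
      (state F η β βsq lam x₁ (fun j => batch j ω) (fun s => ξ s ω) k).next ⊆ D := fun k hk =>
    hsω (k + 1) (Finset.mem_Icc.2 ⟨by omega, by omega⟩)
  have hrun : ∀ k ≤ N, state F η β βsq lam x₁ (fun j => batch j ω) (fun s => ξ s ω) k
      = run D F η β βsq lam x₁ e τ (Φ ω) k := by
    intro k hk
    rw [hstate k hk]
    -- The oracle and its extension agree on `D`, and the run stays there.
    refine oracleState_congr_oracle (D := D) (fun x hx => ?_) x₁ _ _ k fun j hj => ?_
    · funext z
      exact (sgradExt_of_mem hx z).symm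
    · rw [← hstate j (hj.trans hk)]
      exact hsegk j (hj.trans hk) (left_mem_segment ℝ _ _)
  obtain ⟨h1, h2⟩ := hω hωE' fun k hk => by
    rw [← hrun k hk]
    exact hsegk k hk
  refine ⟨fun t ht => ?_, ?_⟩
  · rw [Finset.mem_Icc] at ht
    obtain ⟨k, rfl⟩ : ∃ k, t = k + 1 := ⟨t - 1, by omega⟩
    rw [hiter, hrun k (by omega)]
    exact h1 k (by omega)
  · have hsum : ∑ t ∈ Finset.Icc 1 (N + 1), ‖gradient f
        (iter F η β βsq lam x₁ (fun j => batch j ω) (fun s => ξ s ω) t)‖ ^ 2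
        = ∑ k ∈ Finset.range (N + 1),
          ‖gradient f (run D F η β βsq lam x₁ e τ (Φ ω) k).x‖ ^ 2 := by
      refine Finset.sum_nbij' (fun t => t - 1) (fun k => k + 1) ?_ ?_ ?_ ?_ ?_
      · intro t ht; rw [Finset.mem_Icc] at ht; rw [Finset.mem_range]; omega
      · intro k hk; rw [Finset.mem_range] at hk; rw [Finset.mem_Icc]; omega
      · intro t ht; rw [Finset.mem_Icc] at ht; omega
      · intro k _; omega
      · intro t ht
        rw [Finset.mem_Icc] at ht
        rw [← hrun (t - 1) (by omega)]
        rfl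
    rw [hsum, one_div_mul_eq_div, div_le_iff₀ (by positivity)]
    push_cast
    exact h2

end Transfer

/-! ### Gradient complexity -/

/-- The parameters can be chosen so that the number of stochastic gradients is `O(ε⁻³)`. -/
theorem exists_choice_gradEvals_le {c C δ ρ lam σ L₀ Lρ Δ G : ℝ} (hc : 0 < c) (hC : 0 < C)
    (hδ : 0 < δ) (hlam : 0 < lam) (hL₀ : 0 ≤ L₀) (hLρ : 0 ≤ Lρ) (hL : 0 < L₀ + Lρ)
    (hΔ : 0 < Δ) (hG : 0 < G) :
    ∃ K : ℝ, ∀ ε : ℝ, 0 < ε → ε ≤ 1 → ∃ (η β : ℝ) (T S₁ : ℕ),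
      Choice c C δ ρ lam σ L₀ Lρ Δ ε G η β T S₁ ∧ (gradEvals S₁ T : ℝ) ≤ K * ε ^ (-3 : ℤ) := by
  have hLpos : 0 < effL ρ L₀ Lρ G := by
    unfold effL
    have hGρ : 0 < G ^ ρ := Real.rpow_pos_of_pos hG ρ
    rcases hL₀.eq_or_lt with h | h
    · have : 0 < Lρ := by linarith
      positivity
    · positivity
  set L := effL ρ L₀ Lρ G with hLdef
  set θ := 40 * L * √G * lam ^ (-(3 / 2) : ℝ) with hθdef
  have hθ : 0 < θ := by
    have : 0 < √G := Real.sqrt_pos.2 hG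
    positivity
  have hdiv : ∀ a b : ℝ, 0 < a → 0 < ENNReal.ofReal a / ENNReal.ofReal b := fun a b ha =>
    ENNReal.div_pos (by simpa using ha) ENNReal.ofReal_ne_top
  have hRpos : 0 < effR ρ L₀ Lρ G := by
    unfold effR
    refine lt_min (ENNReal.inv_pos.2 ENNReal.ofReal_ne_top) ?_
    split_ifs
    · exact ENNReal.zero_lt_top
    · exact ENNReal.inv_pos.2 ENNReal.ofReal_ne_top
  set s := stepBound δ ρ lam σ L₀ Lρ Δ 1 G with hs
  have hspos : 0 < s := by
    rw [hs, stepBound]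
    have h1 : 0 < √δ := Real.sqrt_pos.2 hδ
    refine lt_min (lt_min ?_ (hdiv _ _ hlam)) (lt_min (hdiv _ _ (by positivity))
      (hdiv _ _ (by positivity)))
    exact ENNReal.mul_pos hRpos.ne' (by simpa using div_pos hlam hG)
  have hs_ne_top : s ≠ ∞ := by
    have h1 : s ≤ ENNReal.ofReal lam / ENNReal.ofReal L :=
      (min_le_left _ _).trans (min_le_right _ _)
    rw [← ENNReal.ofReal_div_of_pos hLpos] at h1
    exact ne_top_of_le_ne_top ENNReal.ofReal_ne_top h1
  have hsr : 0 < s.toReal := ENNReal.toReal_pos hspos.ne' hs_ne_top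
  -- The first entry enforces the step bound at `ε = 1`, the second gives `β ≤ 1`.
  set η₀ := min (c * s.toReal) θ⁻¹ with hη₀
  have hη₀pos : 0 < η₀ := lt_min (by positivity) (by positivity)
  set K₁ := C * (G * Δ / (η₀ * δ)) with hK₁
  have hK₁pos : 0 < K₁ := by positivity
  set K₂ := 2 * (θ ^ 2 * η₀ ^ 2) ^ 2 * K₁ with hK₂
  have hK₂pos : 0 < K₂ := by positivity
  refine ⟨K₂⁻¹ + 1 + 2 * (K₁ + 1), fun ε hε hε1 => ?_⟩
  set η := η₀ * ε with hη
  have hηpos : 0 < η := by positivity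
  set β := θ ^ 2 * η ^ 2 with hβ
  have hβpos : 0 < β := by positivity
  set q := C * (G * Δ / (η * δ * ε ^ 2)) with hq
  have hqeq : q * ε ^ 3 = K₁ := by rw [hq, hK₁, hη]; field_simp
  have hqpos : 0 < q := by positivity
  set T := ⌈q⌉₊ with hT
  have hqT : q ≤ T := Nat.le_ceil q
  have hTpos : (0 : ℝ) < T := hqpos.trans_le hqT
  set S₁ := ⌈(2 * β ^ 2 * (T : ℝ))⁻¹⌉₊ with hS
  have hden : 0 < 2 * β ^ 2 * (T : ℝ) := by positivity
  refine ⟨η, β, T, S₁, ⟨hηpos, ?_, rfl, ?_, rfl, ?_⟩, ?_⟩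
  -- Only the last entry of `stepBound` depends on `ε`, and it is linear in it; so for `ε ≤ 1`
  -- scaling the whole minimum by `ε` is admissible.
  · have h1 : ENNReal.ofReal ε * s ≤ stepBound δ ρ lam σ L₀ Lρ Δ ε G := by
      have hε' : ENNReal.ofReal ε ≤ 1 := by simpa using hε1
      have hself : ∀ a : ℝ≥0∞, ENNReal.ofReal ε * a ≤ a := fun a =>
        mul_le_of_le_one_left' hε'
      rw [hs, stepBound, stepBound]
      refine le_min (le_min ?_ ?_) (le_min ?_ ?_)
      · exact (mul_le_mul_right ((min_le_left _ _).trans (min_le_left _ _)) _).trans (hself _)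
      · exact (mul_le_mul_right ((min_le_left _ _).trans (min_le_right _ _)) _).trans (hself _)
      · exact (mul_le_mul_right ((min_le_right _ _).trans (min_le_left _ _)) _).trans (hself _)
      · refine (mul_le_mul_right ((min_le_right _ _).trans (min_le_right _ _)) _).trans
          (le_of_eq ?_)
        rw [← mul_div_assoc, ← ENNReal.ofReal_mul hε.le]
        congr 2
        ring
    calc ENNReal.ofReal η ≤ ENNReal.ofReal (c * (ε * s.toReal)) := by
          refine ENNReal.ofReal_le_ofReal ?_
          calc η = η₀ * ε := rfl
            _ ≤ c * s.toReal * ε := by gcongr; exact min_le_left _ _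
            _ = _ := by ring
      _ = ENNReal.ofReal c * (ENNReal.ofReal ε * s) := by
          rw [ENNReal.ofReal_mul hc.le, ENNReal.ofReal_mul hε.le, ENNReal.ofReal_toReal hs_ne_top]
      _ ≤ _ := mul_le_mul_right h1 _
  · have h1 : θ * η ≤ 1 := by
      calc θ * η ≤ θ * (θ⁻¹ * 1) := by rw [hη]; gcongr; exact min_le_right _ _
        _ = 1 := by field_simp
    rw [hβ, ← mul_pow]
    exact pow_le_one₀ (by positivity) h1
  · rw [← ENNReal.ofReal_inv_of_pos hden, ← ENNReal.ofReal_natCast]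
    exact ENNReal.ofReal_le_ofReal (Nat.le_ceil _)
  · have hinv : ε ^ (-3 : ℤ) = (ε ^ 3)⁻¹ := by
      rw [zpow_neg]; rfl
    have hε3 : 0 < ε ^ 3 := by positivity
    have hε31 : ε ^ 3 ≤ 1 := pow_le_one₀ hε.le hε1
    have hTle : (T : ℝ) * ε ^ 3 ≤ K₁ + 1 := by
      have := (Nat.ceil_lt_add_one hqpos.le).le
      calc (T : ℝ) * ε ^ 3 ≤ (q + 1) * ε ^ 3 := by gcongr
        _ = K₁ + ε ^ 3 := by rw [add_mul, hqeq, one_mul]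
        _ ≤ _ := by linarith
    -- Here `β² T` is at least of order `ε⁴ · ε⁻³`, so `S₁` is only of order `ε⁻¹`.
    have hSle : (S₁ : ℝ) * ε ^ 3 ≤ K₂⁻¹ + 1 := by
      have h1 := (Nat.ceil_lt_add_one (inv_pos.2 hden).le).le
      have h2 : K₂ * ε ≤ 2 * β ^ 2 * (T : ℝ) := by
        calc K₂ * ε = 2 * β ^ 2 * q := by
              rw [hK₂, ← hqeq, hβ, hη]; ring
          _ ≤ _ := by gcongr
      have h3 : (2 * β ^ 2 * (T : ℝ))⁻¹ ≤ (K₂ * ε)⁻¹ := inv_anti₀ (by positivity) h2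
      calc (S₁ : ℝ) * ε ^ 3 ≤ ((K₂ * ε)⁻¹ + 1) * ε ^ 3 := by gcongr; linarith
        _ = K₂⁻¹ * ε ^ 2 + ε ^ 3 := by field_simp
        _ ≤ K₂⁻¹ * 1 + 1 := by gcongr; exact pow_le_one₀ hε.le hε1
        _ = _ := by ring
    rw [hinv, ← div_eq_mul_inv, le_div_iff₀ hε3]
    have h4 : (gradEvals S₁ T : ℝ) ≤ S₁ + 2 * T := by
      have : gradEvals S₁ T ≤ S₁ + 2 * T := by unfold gradEvals; omega
      exact_mod_cast this
    calc (gradEvals S₁ T : ℝ) * ε ^ 3 ≤ (S₁ + 2 * T) * ε ^ 3 := by gcongr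
      _ = S₁ * ε ^ 3 + 2 * (T * ε ^ 3) := by ring
      _ ≤ _ := by linarith

end VRAdam

/-! ### The theorem -/

theorem mainTheorem4 :
    ∃ c C : ℝ, 0 < c ∧ 0 < C ∧
      -- convergence with probability at least `1 - δ`
      (∀ (d : ℕ) (D : Set (VRAdam.Vec d)) (f : VRAdam.Vec d → ℝ)
          (Ξ : Type*) [MeasurableSpace Ξ] (P : Measure Ξ) (F : VRAdam.Vec d → Ξ → ℝ)
          (Ω : Type*) [MeasurableSpace Ω] (μ : Measure Ω) [IsProbabilityMeasure μ]
          (δ ρ lam σ L₀ Lρ ε G η β βsq : ℝ) (T S₁ : ℕ) (x₁ : VRAdam.Vec d)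
          (batch : Fin S₁ → Ω → Ξ) (ξ : ℕ → Ω → Ξ),
        0 < δ → δ < 1 → 0 ≤ ρ → ρ < 1 → 0 < lam → 0 ≤ σ → 0 ≤ L₀ → 0 ≤ Lρ → 0 < ε →
        0 ≤ βsq → βsq ≤ 1 →
        -- the objective, bounded below on its domain, and its components
        IsOpen D → x₁ ∈ D → BddBelow (f '' D) →
        VRAdam.GenSmoothOn D ρ L₀ Lρ f →
        (∀ z : Ξ, VRAdam.GenSmoothOn D ρ L₀ Lρ (fun x => F x z)) →
        -- unbiased stochastic gradients with bounded noise
        (∀ x ∈ D, Measurable (VRAdam.sgrad F x)) →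
        (∀ x ∈ D, ∫ z, VRAdam.sgrad F x z ∂P = gradient f x) →
        (∀ x ∈ D, ∀ᵐ z ∂P, ‖VRAdam.sgrad F x z - gradient f x‖ ≤ σ) →
        -- the initial batch and the samples `ξ_2, …, ξ_T` are i.i.d. with law `P`
        (∀ j, HasLaw (batch j) P μ) →
        (∀ t ∈ Finset.Icc 2 T, HasLaw (ξ t) P μ) →
        iIndepFun (Sum.elim batch (fun t : Finset.Icc 2 T => ξ t)) μ →
        -- the parameters
        VRAdam.LargeG C δ ρ lam σ L₀ Lρ (VRAdam.initGap D f x₁) ‖gradient f x₁‖ G →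
        VRAdam.Choice c C δ ρ lam σ L₀ Lρ (VRAdam.initGap D f x₁) ε G η β T S₁ →
        -- the run stays in the domain (no condition if `D = ℝ^d`)
        (∀ t ∈ Finset.Icc 1 T, ∀ᵐ ω ∂μ,
          segment ℝ (VRAdam.iter F η β βsq lam x₁ (fun j => batch j ω) (fun s => ξ s ω) t)
            (VRAdam.iter F η β βsq lam x₁ (fun j => batch j ω) (fun s => ξ s ω) (t + 1)) ⊆ D) →
        1 - δ ≤ μ.real {ω |
          (∀ t ∈ Finset.Icc 1 T, ‖gradient f
            (VRAdam.iter F η β βsq lam x₁ (fun j => batch j ω) (fun s => ξ s ω) t)‖ ≤ G) ∧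
          (1 / (T : ℝ)) * ∑ t ∈ Finset.Icc 1 T, ‖gradient f
            (VRAdam.iter F η β βsq lam x₁ (fun j => batch j ω) (fun s => ξ s ω) t)‖ ^ 2
              ≤ ε ^ 2}) ∧
      -- dimension-free gradient complexity `O(ε⁻³)`
      (∀ δ ρ lam σ L₀ Lρ Δ g₁ G : ℝ,
        0 < δ → δ < 1 → 0 ≤ ρ → ρ < 1 → 0 < lam → 0 ≤ σ → 0 ≤ L₀ → 0 ≤ Lρ → 0 < L₀ + Lρ →
        0 < Δ → VRAdam.LargeG C δ ρ lam σ L₀ Lρ Δ g₁ G →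
        ∃ K : ℝ, ∀ ε : ℝ, 0 < ε → ε ≤ 1 → ∃ (η β : ℝ) (T S₁ : ℕ),
          VRAdam.Choice c C δ ρ lam σ L₀ Lρ Δ ε G η β T S₁ ∧
          (VRAdam.gradEvals S₁ T : ℝ) ≤ K * ε ^ (-3 : ℤ)) := by
  refine ⟨1 / 10 ^ 6, 10 ^ 5, by positivity, by positivity, ?_, ?_⟩
  · intro d D f Ξ _ P F Ω _ μ _ δ ρ lam σ L₀ Lρ ε G η β βsq T S₁ x₁ batch ξ hδ _ hρ hρ1 hlam hσ hL₀
      hLρ hε hβ0 hβ1 hD hx₁ hbdd hf hF hmeas hmean hnoise hbatch hξ hind hG hch hseg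
    obtain ⟨hT, hr⟩ := hch.runRegime hG hδ hρ1 hlam hσ hL₀ hLρ hε
    have hp : VRAdam.Problem D f P F ρ σ L₀ Lρ :=
      ⟨hρ, hρ1, hσ, hL₀, hLρ, hD, hbdd, hf, hF, hmeas, hmean, hnoise⟩
    -- Since `T ≥ 1`, times `1, …, T` correspond to state indices `0, …, N` with `T = N + 1`.
    generalize T - 1 = N at hT hr
    subst hT
    exact VRAdam.convergence hp hr hx₁ hG.grad_le hβ0 hβ1 hbatch hξ hind hseg
  · intro δ ρ lam σ L₀ Lρ Δ g₁ G hδ _ _ _ hlam _ hL₀ hLρ hL hΔ hG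
    exact VRAdam.exists_choice_gradEvals_le (by positivity) (by positivity) hδ hlam hL₀ hLρ hL hΔ hG.pos
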